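/- Let $V_0$ be a finite-dimensional real vector space and let $R\subset V_0$ be a finite reduced root system, not necessarily crystallographic and not necessarily spanning $V_0$, with coroots $\alpha^\vee\in V_0^*$, so that $s_\alpha(v)=v-\langle v,\alpha^\vee\rangle\alpha$. Let $W\subset GL(V_0)$ be the (finite) group generated by the reflections $s_\alpha$, $\alpha\in R$, let $\Pi\subset R$ be a set of simple roots, let $w_0$ be the longest element of $W$, and put $V=\mathbb C\otimes_{\mathbb R}V_0$. Let $k:\Pi\to\mathbb C$ be a function with $k_\alpha=k_{\alpha'}$ whenever $\alpha,\alpha'\in\Pi$ lie in the same $W$-orbit. Let $\mathbb H$ be the graded affine Hecke algebra: the unital associative $\mathbb C$-algebra generated by $t_w$ $(w\in W)$ and $v\in V$, such that $w\mapsto t_w$ and $v\mapsto v$ extend to algebra homomorphisms from $\mathbb C[W]$ and from the symmetric algebra $S(V)$, subject to $$t_{s_\alpha}v-s_\alpha(v)\,t_{s_\alpha}=k_\alpha\langle v,\alpha^\vee\rangle\qquad(\alpha\in\Pi,\ v\in V).$$ Let $\theta,\iota$ be the algebra automorphisms of $\mathbb H$ with $\theta(v)=-w_0(v)$, $\theta(t_w)=t_{w_0ww_0^{-1}}$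 and $\iota(v)=-v$, $\iota(t_w)=\operatorname{sgn}(w)t_w$, where $\operatorname{sgn}(w)=\det w$; let $\bullet,*$ be the $\mathbb C$-linear anti-involutions of $\mathbb H$ with $v^\bullet=v$, $t_w^\bullet=t_w^{-1}$ and $v^*=t_{w_0}\theta(v)t_{w_0}^{-1}$, $t_w^*=t_w^{-1}$. For a finite-dimensional $\mathbb H$-module $X$, let $X^\bullet$ (resp. $X^*$) be the space of linear functionals on $X$ with $(h\cdot f)(x)=f(h^\bullet x)$ (resp. $f(h^*x)$), let $\iota(X)$ be the space $X$ with $h$ acting as $\iota(h)$, and put $\mathbb D(X)=\iota(X^\bullet)^*$. For $J\subset\Pi$ let $W_J=\langle s_\alpha:\alpha\in J\rangle$, let $\mathbb H_J\subset\mathbb H$ be the subalgebra generated by $V$ and the $t_w$ with $w\in W_J$, and put $\operatorname{Ind}_{\mathbb H_J}^{\mathbb H}\operatorname{Res}_{\mathbb H_J}X=\mathbb H\otimes_{\mathbb H_J}X$, which is finite-dimensional if $X$ is. Let $G(\mathbb H)$ be the Grothendieck group of finite-dimensional $\mathbb H$-modules (with relations from short exact sequences), and $[X]$ the class of $X$ in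 it. **Theorem.** The rule $$\widetilde{\mathbb D}([X])=\sum_{J\subset\Pi}(-1)^{|J|}\,\bigl[\operatorname{Ind}_{\mathbb H_J}^{\mathbb H}\operatorname{Res}_{\mathbb H_J}X\bigr]\qquad(X\text{ a finite-dimensional }\mathbb H\text{-module})$$ defines a group endomorphism $\widetilde{\mathbb D}$ of $G(\mathbb H)$. Every irreducible $\mathbb H$-module $X$ is finite-dimensional and satisfies $$[\mathbb D(X)]=\widetilde{\mathbb D}([X])\quad\text{in }G(\mathbb H).$$ -/

import Mathlib

open scoped TensorProduct

universe u v w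

namespace GradedHecke

section Roots

variable {ι N : Type*} {V₀ : Type u} [AddCommGroup V₀] [Module ℝ V₀] [AddCommGroup N] [Module ℝ N]

/-- The reflection group of the roots: the group of automorphisms of `V₀` generated by the
reflections in all the roots. -/
def reflectionGroup (P : RootPairing ι ℝ V₀ N) : Subgroup (V₀ ≃ₗ[ℝ] V₀) :=
  Subgroup.closure (Set.range P.reflection)

/-- The reflection in the root `i`, as an element of the reflection group. -/
def refl (P : RootPairing ι ℝ V₀ N) (i : ι) : reflectionGroup P :=
  ⟨P.reflection i, Subgroup.subset_closure (Set.mem_range_self i)⟩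

/-- A choice of simple roots: a linearly independent set of roots such that every root is a real
linear combination of them with all coefficients `≥ 0` or all coefficients `≤ 0`. (The coefficients
are not required to be integers, since the root system need not be crystallographic.) -/
structure SimpleRoots (P : RootPairing ι ℝ V₀ N) where
  /-- the index set of the simple roots -/
  support : Finset ι
  linearIndepOn : LinearIndepOn ℝ P.root (support : Set ι)
  nonneg_or_nonpos : ∀ i : ι,
    (∃ c : ι → ℝ, (∀ a, 0 ≤ c a) ∧ P.root i = ∑ a ∈ support, c a • P.root a) ∨
    (∃ c : ι → ℝ, (∀ a, 0 ≤ c a) ∧ P.root i = -∑ a ∈ support, c a • P.root a)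

variable {P : RootPairing ι ℝ V₀ N}

/-- The set `R⁺` of positive roots, as vectors of `V₀`. -/
def SimpleRoots.posRoots (b : SimpleRoots P) : Set V₀ :=
  {x | x ∈ Set.range P.root ∧
    ∃ c : ι → ℝ, (∀ a, 0 ≤ c a) ∧ x = ∑ a ∈ b.support, c a • P.root a}

/-- The length of an element of the reflection group: the number of positive roots which it maps to
negative roots. -/
noncomputable def SimpleRoots.length (b : SimpleRoots P) (w : reflectionGroup P) : ℕ :=
  Set.ncard {x : V₀ | x ∈ b.posRoots ∧ -(w.1 x) ∈ b.posRoots}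

theorem exists_root (w : reflectionGroup P) (i : ι) :
    ∃ j, P.root j = w.1 (P.root i) ∧ ∀ v, P.coroot' j (w.1 v) = P.coroot' i v := by
  obtain ⟨w, hw⟩ := w
  have step : ∀ (k : ι) (y : V₀ ≃ₗ[ℝ] V₀),
      (∀ i, ∃ j, P.root j = y (P.root i) ∧ ∀ v, P.coroot' j (y v) = P.coroot' i v) →
      ∀ i, ∃ j, P.root j = (P.reflection k * y) (P.root i) ∧
        ∀ v, P.coroot' j ((P.reflection k * y) v) = P.coroot' i v := by
    intro k y ih i
    obtain ⟨j, hj, hj'⟩ := ih i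
    refine ⟨P.reflectionPerm k j, ?_, ?_⟩
    · rw [P.root_reflectionPerm, hj]; rfl
    · intro v
      rw [← hj', P.coroot'_reflectionPerm]
      simp
  change ∃ j, P.root j = w (P.root i) ∧ ∀ v, P.coroot' j (w v) = P.coroot' i v
  induction hw using Subgroup.closure_induction_left generalizing i with
  | one => exact ⟨i, rfl, fun v => rfl⟩
  | mul_left x hx y hy ih =>
    obtain ⟨k, rfl⟩ := hx
    exact step k y ih i
  | inv_mul_cancel x hx y hy ih =>
    obtain ⟨k, rfl⟩ := hx
    rw [P.reflection_inv]
    exact step k y ih i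

theorem coroot'_apply (w : reflectionGroup P) {i j : ι} (h : P.root j = w.1 (P.root i)) (v : V₀) :
    P.coroot' j (w.1 v) = P.coroot' i v := by
  obtain ⟨j', hj, hj'⟩ := exists_root w i
  have : j' = j := P.root.injective (hj.trans h.symm)
  exact this ▸ hj' v

theorem mul_refl_mul_inv (w : reflectionGroup P) {i j : ι} (h : P.root j = w.1 (P.root i)) :
    w * refl P i * w⁻¹ = refl P j := by
  apply Subtype.ext
  apply LinearEquiv.ext
  intro v
  have hv : w.1 (w.1⁻¹ v) = v := by
    rw [← LinearEquiv.mul_apply, mul_inv_cancel]; rfl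
  have := coroot'_apply w h (w.1⁻¹ v)
  rw [hv] at this
  change w.1 (P.reflection i (w.1⁻¹ v)) = P.reflection j v
  rw [P.reflection_apply, P.reflection_apply, map_sub, map_smul, hv, ← this, h]

theorem refl_mul_self (i : ι) : refl P i * refl P i = 1 := by
  apply Subtype.ext
  apply LinearEquiv.ext
  intro v
  exact P.reflection_same i v

theorem refl_inv (i : ι) : (refl P i)⁻¹ = refl P i :=
  inv_eq_of_mul_eq_one_left (refl_mul_self i)

theorem finite_reflectionGroup [Finite ι] (P : RootPairing ι ℝ V₀ N) :
    Finite (reflectionGroup P) := by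
  classical
  have := Fintype.ofFinite ι
  let φ : reflectionGroup P → (ι → ι) := fun w i => (exists_root w i).choose
  have hφ : ∀ w i, P.root (φ w i) = w.1 (P.root i) := fun w i => (exists_root w i).choose_spec.1
  refine Finite.of_injective φ fun w w' h => ?_
  have hfix : ∀ i, P.root i = (w⁻¹ * w').1 (P.root i) := by
    intro i
    have : w.1 (P.root i) = w'.1 (P.root i) := by rw [← hφ, ← hφ, h]
    change P.root i = w.1⁻¹ (w'.1 (P.root i))
    rw [← this, ← LinearEquiv.mul_apply, inv_mul_cancel]; rfl
  have hspan : ∀ (u : reflectionGroup P) (v : V₀), u.1 v - v ∈ P.rootSpan ℝ := by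
    rintro ⟨u, hu⟩
    induction hu using Subgroup.closure_induction with
    | mem x hx =>
      obtain ⟨k, rfl⟩ := hx
      intro v
      rw [P.reflection_apply, sub_sub_cancel_left]
      exact neg_mem (Submodule.smul_mem _ _ (Submodule.subset_span (Set.mem_range_self k)))
    | one => intro v; simp
    | mul x y hx hy h1 h2 =>
      intro v
      have : (x * y) v - v = (x (y v) - y v) + (y v - v) := by simp
      change (x * y) v - v ∈ _
      rw [this]
      exact add_mem (h1 _) (h2 _)
    | inv x hx h1 =>
      intro v
      have h2 : x (x⁻¹ v) = v := by rw [← LinearEquiv.mul_apply, mul_inv_cancel]; rfl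
      have := h1 (x⁻¹ v)
      change x (x⁻¹ v) - x⁻¹ v ∈ _ at this
      rw [h2] at this
      change x⁻¹ v - v ∈ _
      rw [← neg_sub]
      exact neg_mem this
  have h1 : w⁻¹ * w' = 1 := by
    apply Subtype.ext
    apply LinearEquiv.ext
    intro v
    set u := w⁻¹ * w'
    have : u.1 v - v = 0 := by
      apply P.eq_zero_of_mem_rootSpan_of_rootForm_self_eq_zero (hspan u v)
      rw [P.rootForm_apply_apply]
      refine Finset.sum_eq_zero fun i _ => ?_
      rw [map_sub, coroot'_apply u (hfix i), sub_self, zero_mul]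
    exact sub_eq_zero.mp this
  exact inv_mul_eq_one.mp h1

variable (b : SimpleRoots P)

theorem coeff_unique {c d : ι → ℝ}
    (h : ∑ a ∈ b.support, c a • P.root a = ∑ a ∈ b.support, d a • P.root a) :
    ∀ a ∈ b.support, c a = d a := by
  have h1 := linearIndepOn_iff'.mp b.linearIndepOn b.support (fun a => c a - d a) le_rfl
    (by simp only [sub_smul, Finset.sum_sub_distrib, h, sub_self])
  exact fun a ha => sub_eq_zero.mp (h1 a ha)

theorem simple_mem {α : ι} (hα : α ∈ b.support) : P.root α ∈ b.posRoots := by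
  classical
  refine ⟨⟨α, rfl⟩, fun a => if a = α then 1 else 0, fun a => by dsimp only; split_ifs <;> simp, ?_⟩
  simp [ite_smul, hα]

theorem neg_notMem {x : V₀} (hx : x ∈ b.posRoots) : -x ∉ b.posRoots := by
  rintro ⟨-, d, hd, hd'⟩
  obtain ⟨⟨i, rfl⟩, c, hc, hc'⟩ := hx
  have h1 : ∑ a ∈ b.support, (c a + d a) • P.root a =
      ∑ a ∈ b.support, (0 : ι → ℝ) a • P.root a := by
    simp only [add_smul, Finset.sum_add_distrib, ← hc', ← hd']
    simp
  have h2 := coeff_unique b h1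
  apply P.ne_zero i
  rw [hc']
  refine Finset.sum_eq_zero fun a ha => ?_
  have h3 := h2 a ha
  simp only [Pi.zero_apply] at h3
  have : c a = 0 := le_antisymm (by linarith [hd a]) (hc a)
  rw [this, zero_smul]

theorem mem_or_neg_mem {x : V₀} (hx : x ∈ Set.range P.root) :
    x ∈ b.posRoots ∨ -x ∈ b.posRoots := by
  obtain ⟨i, rfl⟩ := hx
  rcases b.nonneg_or_nonpos i with ⟨c, hc, h⟩ | ⟨c, hc, h⟩
  · exact Or.inl ⟨⟨i, rfl⟩, c, hc, h⟩
  · exact Or.inr ⟨⟨P.reflectionPerm i i, by simp⟩, c, hc, by rw [h, neg_neg]⟩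

theorem apply_mem_range (w : reflectionGroup P) {x : V₀} (hx : x ∈ Set.range P.root) :
    w.1 x ∈ Set.range P.root := by
  obtain ⟨i, rfl⟩ := hx
  obtain ⟨j, hj, -⟩ := exists_root w i
  exact ⟨j, hj⟩

theorem eq_simple [P.IsReduced] {x : V₀} (hx : x ∈ b.posRoots) {α : ι} (hα : α ∈ b.support)
    {r : ℝ} (h : x = r • P.root α) : x = P.root α := by
  obtain ⟨⟨i, rfl⟩, hc⟩ := id hx
  have h1 : ¬ LinearIndependent ℝ ![P.root i, P.root α] := by
    rw [LinearIndependent.pair_iff]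
    intro h2
    have := (h2 1 (-r) (by rw [h]; simp)).1
    exact one_ne_zero this
  rcases RootPairing.IsReduced.eq_or_eq_neg i α h1 with h2 | h2
  · exact h2
  · have := neg_notMem b (simple_mem b hα)
    rw [← h2] at this
    exact absurd hx this

/-- A simple reflection permutes the positive roots other than its own simple root. -/
theorem refl_mem [P.IsReduced] {x : V₀} (hx : x ∈ b.posRoots) {α : ι} (hα : α ∈ b.support)
    (hne : x ≠ P.root α) : P.reflection α x ∈ b.posRoots := by
  classical
  rcases mem_or_neg_mem b (apply_mem_range (refl P α) hx.1) with h | h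
  · exact h
  exfalso
  apply hne
  obtain ⟨-, d, hd, hd'⟩ := h
  obtain ⟨hr, c, hc, hc'⟩ := id hx
  change -(P.reflection α x) = _ at hd'
  rw [P.reflection_apply] at hd'
  have h1 : ∑ a ∈ b.support, (c a + d a) • P.root a =
      ∑ a ∈ b.support, (fun a => if a = α then P.coroot' α x else 0) a • P.root a := by
    simp only [add_smul, Finset.sum_add_distrib, ← hc', ← hd', ite_smul, zero_smul,
      Finset.sum_ite_eq', hα, if_true]
    abel
  have h2 := coeff_unique b h1
  have h3 : ∀ a ∈ b.support, a ≠ α → c a = 0 := by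
    intro a ha hne
    have := h2 a ha
    simp only [hne, if_false] at this
    exact le_antisymm (by linarith [hd a]) (hc a)
  refine eq_simple b hx hα (r := c α) ?_
  rw [hc']
  exact Finset.sum_eq_single_of_mem α hα fun a ha hne => by rw [h3 a ha hne, zero_smul]

theorem finite_posRoots [Finite ι] : b.posRoots.Finite :=
  (Set.finite_range P.root).subset fun _ hx => hx.1

theorem exists_longest [Finite ι] : ∃ w₀ : reflectionGroup P, ∀ w, b.length w ≤ b.length w₀ := by
  have := finite_reflectionGroup P
  exact Finite.exists_max b.length

/-- The longest element `w₀` of the reflection group. -/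
noncomputable def SimpleRoots.longest [Finite ι] (b : SimpleRoots P) : reflectionGroup P :=
  (exists_longest b).choose

theorem length_le_longest [Finite ι] (w : reflectionGroup P) :
    b.length w ≤ b.length b.longest := (exists_longest b).choose_spec w

theorem neg_longest_simple [Finite ι] [P.IsReduced] {α : ι} (hα : α ∈ b.support) :
    -(b.longest.1 (P.root α)) ∈ b.posRoots := by
  rcases mem_or_neg_mem b (apply_mem_range b.longest (simple_mem b hα).1) with h | h
  swap
  · exact h
  exfalso
  set w := b.longest with hw
  have key : b.length w < b.length (w * refl P α) := by
    have hfin : {x : V₀ | x ∈ b.posRoots ∧ -((w * refl P α).1 x) ∈ b.posRoots}.Finite :=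
      (finite_posRoots b).subset fun x hx => hx.1
    have himg : P.reflection α '' {x : V₀ | x ∈ b.posRoots ∧ -(w.1 x) ∈ b.posRoots} ⊂
        {x : V₀ | x ∈ b.posRoots ∧ -((w * refl P α).1 x) ∈ b.posRoots} := by
      refine (Set.ssubset_iff_of_subset ?_).mpr ⟨P.root α, ⟨simple_mem b hα, ?_⟩, ?_⟩
      · rintro _ ⟨x, ⟨hx, hx'⟩, rfl⟩
        have hne : x ≠ P.root α := by
          rintro rfl
          exact neg_notMem b h hx'
        refine ⟨refl_mem b hx hα hne, ?_⟩
        change -(w.1 (P.reflection α (P.reflection α x))) ∈ _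
        rwa [P.reflection_same]
      · change -(w.1 (P.reflection α (P.root α))) ∈ _
        rwa [P.reflection_apply_self, map_neg, neg_neg]
      · rintro ⟨x, ⟨hx, -⟩, hx'⟩
        have : x = -P.root α := by
          rw [← P.reflection_same α x, hx', P.reflection_apply_self]
        rw [this] at hx
        exact neg_notMem b (simple_mem b hα) hx
    have h1 := Set.ncard_lt_ncard himg hfin
    rwa [Set.ncard_image_of_injective _ (P.reflection α).injective] at h1
  exact absurd (length_le_longest b (w * refl P α)) (not_le.mpr key)

theorem neg_longest_pos [Finite ι] [P.IsReduced] {x : V₀} (hx : x ∈ b.posRoots) :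
    -(b.longest.1 x) ∈ b.posRoots := by
  obtain ⟨hr, c, hc, hc'⟩ := id hx
  choose! d hd using fun a (ha : a ∈ b.support) => (neg_longest_simple b ha).2
  refine ⟨?_, fun a => ∑ α ∈ b.support, c α * d α a, ?_, ?_⟩
  · obtain ⟨i, hi⟩ := apply_mem_range b.longest hr
    exact ⟨P.reflectionPerm i i, by rw [← hi]; simp⟩
  · intro a
    exact Finset.sum_nonneg fun α hα => mul_nonneg (hc α) ((hd α hα).1 a)
  · conv_lhs => rw [hc']
    rw [map_sum, ← Finset.sum_neg_distrib]
    simp only [map_smul, Finset.sum_smul, mul_smul]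
    rw [Finset.sum_comm]
    refine Finset.sum_congr rfl fun α hα => ?_
    rw [← smul_neg, (hd α hα).2, Finset.smul_sum]

/-- `-w₀` permutes the simple roots. -/
theorem exists_neg_longest [Finite ι] [P.IsReduced] {α : ι} (hα : α ∈ b.support) :
    ∃ β ∈ b.support, P.root β = -(b.longest.1 (P.root α)) := by
  classical
  set w := b.longest with hw
  have hinv : ∀ v, w.1 (w.1⁻¹ v) = v := fun v => by
    rw [← LinearEquiv.mul_apply, mul_inv_cancel]; rfl
  have hinv' : ∀ v, w.1⁻¹ (w.1 v) = v := fun v => by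
    rw [← LinearEquiv.mul_apply, inv_mul_cancel]; rfl
  obtain ⟨⟨i, hi⟩, c, hc, hc'⟩ := neg_longest_simple b hα
  rw [← hw] at hi hc'
  have hpos : ∀ β ∈ b.support, -(w.1⁻¹ (P.root β)) ∈ b.posRoots := by
    intro β hβ
    rcases mem_or_neg_mem b (apply_mem_range w⁻¹ (simple_mem b hβ).1) with h | h
    · have := neg_longest_pos b h
      rw [← hw] at this
      change -(w.1 (w.1⁻¹ _)) ∈ _ at this
      rw [hinv] at this
      exact absurd this (neg_notMem b (simple_mem b hβ))
    · exact h
  choose! d hd using fun β (hβ : β ∈ b.support) => (hpos β hβ).2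
  have hsum : ∑ a ∈ b.support, (∑ β ∈ b.support, c β * d β a) • P.root a =
      ∑ a ∈ b.support, (fun a => if a = α then (1 : ℝ) else 0) a • P.root a := by
    have h1 : P.root α = ∑ β ∈ b.support, c β • -(w.1⁻¹ (P.root β)) := by
      have := congrArg (fun v => -(w.1⁻¹ v)) hc'
      simp only [map_neg, neg_neg, hinv'] at this
      rw [this, map_sum, ← Finset.sum_neg_distrib]
      exact Finset.sum_congr rfl fun β _ => by rw [map_smul, smul_neg]
    simp only [ite_smul, one_smul, zero_smul, Finset.sum_ite_eq', hα, if_true]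
    rw [h1]
    simp only [Finset.sum_smul, mul_smul]
    rw [Finset.sum_comm]
    refine Finset.sum_congr rfl fun β hβ => ?_
    rw [(hd β hβ).2, Finset.smul_sum]
  have hco := coeff_unique b hsum
  obtain ⟨β, hβ, hcβ⟩ : ∃ β ∈ b.support, c β ≠ 0 := by
    by_contra! hcon
    apply P.ne_zero i
    rw [hi, hc']
    exact Finset.sum_eq_zero fun β hβ => by rw [hcon β hβ, zero_smul]
  refine ⟨β, hβ, ?_⟩
  have hd0 : ∀ a ∈ b.support, a ≠ α → d β a = 0 := by
    intro a ha hne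
    have h1 := hco a ha
    simp only [hne, if_false] at h1
    have h2 := (Finset.sum_eq_zero_iff_of_nonneg
      (fun β hβ => mul_nonneg (hc β) ((hd β hβ).1 a))).mp h1 β hβ
    exact (mul_eq_zero.mp h2).resolve_left hcβ
  have h3 : -(w.1⁻¹ (P.root β)) = P.root α := by
    refine eq_simple b (hpos β hβ) hα (r := d β α) ?_
    rw [(hd β hβ).2]
    exact Finset.sum_eq_single_of_mem α hα fun a ha hne => by rw [hd0 a ha hne, zero_smul]
  rw [← h3, map_neg, neg_neg, hinv]

/-- The reflection group is generated by the simple reflections. -/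
theorem closure_simple [Finite ι] [P.IsReduced] :
    Subgroup.closure (refl P '' (b.support : Set ι)) = ⊤ := by
  classical
  have := Fintype.ofFinite ι
  set G := Subgroup.closure (refl P '' (b.support : Set ι)) with hG
  have hsimple : ∀ α ∈ b.support, refl P α ∈ G := fun α hα =>
    Subgroup.subset_closure ⟨α, hα, rfl⟩
  -- every positive root is conjugate under `G` to a simple root
  have hconj : ∀ i, P.root i ∈ b.posRoots → ∃ g ∈ G, ∃ α ∈ b.support, P.root α = g.1 (P.root i) := by
    choose! c hc using fun j (hj : P.root j ∈ b.posRoots) => hj.2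
    let ht : ι → ℝ := fun j => ∑ a ∈ b.support, c j a
    intro i hi
    let S : Set ι := {j | P.root j ∈ b.posRoots ∧ ∃ g ∈ G, P.root j = g.1 (P.root i)}
    have hSne : S.Nonempty := ⟨i, hi, 1, one_mem _, rfl⟩
    obtain ⟨j, ⟨hj, g, hg, hgj⟩, hmin⟩ := Set.exists_min_image S ht (Set.toFinite S) hSne
    by_cases hjs : j ∈ b.support
    · exact ⟨g, hg, j, hjs, hgj⟩
    exfalso
    obtain ⟨α, hα, hpα⟩ : ∃ α ∈ b.support, 0 < P.coroot' α (P.root j) := by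
      by_contra! hcon
      have h0 : 0 < P.RootForm (P.root j) (P.root j) :=
        P.rootForm_pos_of_ne_zero (Submodule.subset_span (Set.mem_range_self j)) (P.ne_zero j)
      have h1 : P.RootForm (P.root j) (P.root j) =
          ∑ a ∈ b.support, c j a * P.RootForm (P.root j) (P.root a) := by
        have h2 := congrArg (P.RootForm (P.root j)) (hc j hj).2
        rw [map_sum] at h2
        simpa using h2
      have h2 : ∀ a ∈ b.support, P.RootForm (P.root j) (P.root a) ≤ 0 := by
        intro a ha
        have h3 := P.toInvariantForm.two_mul_apply_root_root j a
        simp only [RootPairing.toInvariantForm_form] at h3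
        have h4 : P.pairing j a ≤ 0 := hcon a ha
        have h5 := P.zero_le_rootForm (P.root a)
        nlinarith
      rw [h1] at h0
      exact absurd h0 (not_lt.mpr (Finset.sum_nonpos fun a ha =>
        mul_nonpos_of_nonneg_of_nonpos ((hc j hj).1 a) (h2 a ha)))
    have hjα : P.root j ≠ P.root α := fun h => hjs (P.root.injective h ▸ hα)
    have hpos := refl_mem b hj hα hjα
    rw [← P.root_reflectionPerm] at hpos
    have hle := hmin (P.reflectionPerm α j) ⟨hpos, refl P α * g, mul_mem (hsimple α hα) hg, by
      rw [P.root_reflectionPerm, hgj]; rfl⟩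
    have hco : ∀ a ∈ b.support, c (P.reflectionPerm α j) a =
        c j a - if a = α then P.coroot' α (P.root j) else 0 := by
      apply coeff_unique b
      rw [← (hc _ hpos).2, P.root_reflectionPerm, P.reflection_apply]
      simp only [sub_smul, Finset.sum_sub_distrib, ite_smul, zero_smul, Finset.sum_ite_eq', hα,
        if_true, ← (hc j hj).2]
    have : ht (P.reflectionPerm α j) = ht j - P.coroot' α (P.root j) := by
      simp only [ht]
      rw [Finset.sum_congr rfl hco, Finset.sum_sub_distrib, Finset.sum_ite_eq', if_pos hα]
    linarith
  have hpos : ∀ i, P.root i ∈ b.posRoots → refl P i ∈ G := by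
    intro i hi
    obtain ⟨g, hg, α, hα, h⟩ := hconj i hi
    have h1 := mul_refl_mul_inv g h
    have : refl P i = g⁻¹ * refl P α * g := by rw [← h1]; group
    rw [this]
    exact mul_mem (mul_mem (inv_mem hg) (hsimple α hα)) hg
  have hall : ∀ i, refl P i ∈ G := by
    intro i
    rcases mem_or_neg_mem b (Set.mem_range_self i) with h | h
    · exact hpos i h
    · have h1 : P.root (P.reflectionPerm i i) = -P.root i := by simp
      rw [← h1] at h
      have h2 := hpos _ h
      have h3 : refl P i * refl P i * (refl P i)⁻¹ = refl P (P.reflectionPerm i i) :=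
        mul_refl_mul_inv (refl P i) (P.root_reflectionPerm i i)
      rw [mul_inv_cancel_right] at h3
      rwa [← h3] at h2
  rw [eq_top_iff]
  rintro ⟨w, hw⟩ -
  induction hw using Subgroup.closure_induction with
  | mem x hx => obtain ⟨i, rfl⟩ := hx; exact hall i
  | one => exact one_mem G
  | mul x y hx hy h1 h2 => exact mul_mem h1 h2
  | inv x hx h1 => exact inv_mem h1

theorem refl_perm_self (i : ι) : refl P (P.reflectionPerm i i) = refl P i := by
  have h := mul_refl_mul_inv (refl P i) (P.root_reflectionPerm i i)
  rw [mul_inv_cancel_right] at h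
  exact h.symm

theorem exists_list [Finite ι] [P.IsReduced] (w : reflectionGroup P) :
    ∃ L : List b.support, (L.map fun a : b.support => refl P a).prod = w := by
  have hw : w ∈ Subgroup.closure (refl P '' (b.support : Set ι)) := by
    rw [closure_simple b]; trivial
  induction hw using Subgroup.closure_induction_left with
  | one => exact ⟨[], rfl⟩
  | mul_left x hx y hy ih =>
    obtain ⟨a, ha, rfl⟩ := hx
    obtain ⟨L, rfl⟩ := ih
    exact ⟨⟨a, ha⟩ :: L, by simp⟩
  | inv_mul_cancel x hx y hy ih =>
    obtain ⟨a, ha, rfl⟩ := hx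
    obtain ⟨L, rfl⟩ := ih
    exact ⟨⟨a, ha⟩ :: L, by simp [refl_inv]⟩

theorem exchange [P.IsReduced] (L : List b.support) {α : ι} (hα : α ∈ b.support)
    (h : -((L.map fun a : b.support => refl P a).prod.1 (P.root α)) ∈ b.posRoots) :
    ∃ L' : List b.support, L'.length + 1 = L.length ∧
      (L'.map fun a : b.support => refl P a).prod = (L.map fun a : b.support => refl P a).prod * refl P α := by
  induction L with
  | nil => exact absurd h (neg_notMem b (simple_mem b hα))
  | cons a L ih =>
    set u := (L.map fun a : b.support => refl P a).prod with hu
    rw [List.map_cons, List.prod_cons, ← hu] at h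
    rw [List.map_cons, List.prod_cons, ← hu]
    rcases mem_or_neg_mem b (apply_mem_range u (simple_mem b hα).1) with h1 | h1
    · refine ⟨L, rfl, ?_⟩
      by_cases h2 : u.1 (P.root α) = P.root a
      · have h3 := mul_refl_mul_inv u h2.symm
        rw [← hu, ← h3, inv_mul_cancel_right, mul_assoc, refl_mul_self, mul_one]
      · exact absurd h (neg_notMem b (refl_mem b h1 a.2 h2))
    · obtain ⟨L', hL', hL''⟩ := ih h1
      exact ⟨a :: L', by simp [hL'], by rw [List.map_cons, List.prod_cons, hL'', mul_assoc]⟩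

theorem eq_one_of_preserves [Finite ι] [P.IsReduced] (w : reflectionGroup P)
    (hw : ∀ x ∈ b.posRoots, w.1 x ∈ b.posRoots) : w = 1 := by
  have key : ∀ (n : ℕ) (L : List b.support), L.length = n →
      (∀ x ∈ b.posRoots, (L.map fun a : b.support => refl P a).prod.1 x ∈ b.posRoots) →
      (L.map fun a : b.support => refl P a).prod = 1 := by
    intro n
    induction n using Nat.strong_induction_on with
    | _ n ih =>
      intro L hL hpos
      rcases L.eq_nil_or_concat with rfl | ⟨L₀, a, rfl⟩
      · rfl
      · have hp : ((L₀ ++ [a]).map fun a : b.support => refl P a).prod =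
            (L₀.map fun a : b.support => refl P a).prod * refl P (a : ι) := by simp
        rw [List.concat_eq_append] at hL hpos ⊢
        rw [hp] at hpos ⊢
        have h1 := hpos _ (simple_mem b a.2)
        change (L₀.map fun a : b.support => refl P a).prod.1 (P.reflection a (P.root a)) ∈ _ at h1
        rw [P.reflection_apply_self, map_neg] at h1
        obtain ⟨L', hL', hL''⟩ := exchange b L₀ a.2 h1
        rw [← hL''] at hpos ⊢
        refine ih L'.length ?_ L' rfl hpos
        simp at hL
        omega
  obtain ⟨L, rfl⟩ := exists_list b w
  exact key _ L rfl hw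

theorem longest_mul_self [Finite ι] [P.IsReduced] : b.longest * b.longest = 1 := by
  apply eq_one_of_preserves b
  intro x hx
  have := neg_longest_pos b (neg_longest_pos b hx)
  rwa [map_neg, neg_neg] at this

theorem longest_inv [Finite ι] [P.IsReduced] : b.longest⁻¹ = b.longest :=
  inv_eq_of_mul_eq_one_left (longest_mul_self b)

end Roots


section Algebra

variable {ι N : Type*} {V₀ : Type u} [AddCommGroup V₀] [Module ℝ V₀] [AddCommGroup N] [Module ℝ N]
variable {P : RootPairing ι ℝ V₀ N}

/-- The complex-linear action of an element of the reflection group on `V = ℂ ⊗ V₀`. -/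
noncomputable def act (w : reflectionGroup P) : (ℂ ⊗[ℝ] V₀) →ₗ[ℂ] (ℂ ⊗[ℝ] V₀) :=
  (w.1 : V₀ →ₗ[ℝ] V₀).baseChange ℂ

/-- The complex-linear extension to `V = ℂ ⊗ V₀` of the pairing `⟨·, αᵢ^∨⟩` with a coroot. -/
noncomputable def corootC (P : RootPairing ι ℝ V₀ N) (i : ι) : Module.Dual ℂ (ℂ ⊗[ℝ] V₀) :=
  (P.coroot' i).baseChange ℂ

@[simp] theorem act_tmul (w : reflectionGroup P) (z : ℂ) (v : V₀) :
    act w (z ⊗ₜ[ℝ] v) = z ⊗ₜ[ℝ] w.1 v := rfl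

@[simp] theorem corootC_tmul (i : ι) (z : ℂ) (v : V₀) :
    corootC P i (z ⊗ₜ[ℝ] v) = (P.coroot' i v : ℂ) * z := by
  simp [corootC]

theorem act_mul (w w' : reflectionGroup P) (v : ℂ ⊗[ℝ] V₀) :
    act (w * w') v = act w (act w' v) := by
  induction v with
  | zero => simp
  | tmul z v => rfl
  | add x y hx hy => simp only [map_add, hx, hy]

theorem act_one (v : ℂ ⊗[ℝ] V₀) : act (1 : reflectionGroup P) v = v := by
  induction v with
  | zero => simp
  | tmul z v => rfl
  | add x y hx hy => simp only [map_add, hx, hy]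

theorem act_refl_refl (i : ι) (v : ℂ ⊗[ℝ] V₀) : act (refl P i) (act (refl P i) v) = v := by
  rw [← act_mul, refl_mul_self, act_one]

theorem corootC_act (w : reflectionGroup P) {i j : ι} (h : P.root j = w.1 (P.root i))
    (v : ℂ ⊗[ℝ] V₀) : corootC P j (act w v) = corootC P i v := by
  induction v with
  | zero => simp
  | tmul z v => rw [act_tmul, corootC_tmul, corootC_tmul, coroot'_apply w h]
  | add x y hx hy => simp only [map_add, hx, hy]

theorem corootC_refl (i : ι) (v : ℂ ⊗[ℝ] V₀) :
    corootC P i (act (refl P i) v) = -corootC P i v := by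
  induction v with
  | zero => simp
  | tmul z v =>
    rw [act_tmul, corootC_tmul, corootC_tmul]
    have : P.coroot' i ((refl P i).1 v) = -P.coroot' i v := by
      change P.coroot' i (P.reflection i v) = _
      rw [P.reflection_apply, map_sub, map_smul]
      simp
      ring
    rw [this]
    push_cast
    ring
  | add x y hx hy =>
    simp only [map_add, hx, hy]
    ring

/-- A complex parameter function on the simple roots, constant on the intersections of the set of
simple roots with the orbits of the reflection group. -/
structure Parameter (b : SimpleRoots P) where
  /-- the value `k_α` -/
  toFun : b.support → ℂ
  invariant : ∀ (α β : b.support) (w : reflectionGroup P),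
    w.1 (P.root α) = P.root β → toFun α = toFun β

/-- The free algebra on the symbols `t_w` (`w` in the reflection group) and `f_v` (`v ∈ V`). -/
abbrev Free (P : RootPairing ι ℝ V₀ N) : Type u :=
  FreeAlgebra ℂ (reflectionGroup P ⊕ (ℂ ⊗[ℝ] V₀))

/-- The free generator `t_w`. -/
def freeT (w : reflectionGroup P) : Free P := FreeAlgebra.ι ℂ (Sum.inl w)

/-- The free generator `f_v`. -/
def freeF (P : RootPairing ι ℝ V₀ N) (v : ℂ ⊗[ℝ] V₀) : Free P := FreeAlgebra.ι ℂ (Sum.inr v)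

/-- The defining relations of the graded affine Hecke algebra: `w ↦ t_w` is multiplicative and
unital, `v ↦ f_v` is linear with commuting values (so it extends to the symmetric algebra `S(V)`),
and `t_{s_α} v - s_α(v) t_{s_α} = k_α ⟨v, α^∨⟩` for `α` simple. -/
inductive Rel (b : SimpleRoots P) (k : Parameter b) : Free P → Free P → Prop
  | t_one : Rel b k (freeT 1) 1
  | t_mul (w w' : reflectionGroup P) : Rel b k (freeT (w * w')) (freeT w * freeT w')
  | f_add (v v' : ℂ ⊗[ℝ] V₀) : Rel b k (freeF P (v + v')) (freeF P v + freeF P v')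
  | f_smul (z : ℂ) (v : ℂ ⊗[ℝ] V₀) : Rel b k (freeF P (z • v)) (z • freeF P v)
  | f_comm (v v' : ℂ ⊗[ℝ] V₀) : Rel b k (freeF P v * freeF P v') (freeF P v' * freeF P v)
  | cross (α : b.support) (v : ℂ ⊗[ℝ] V₀) :
      Rel b k (freeT (refl P α) * freeF P v - freeF P (act (refl P α) v) * freeT (refl P α))
        (algebraMap ℂ (Free P) (k.toFun α * corootC P α v))

/-- The graded affine Hecke algebra `ℍ(Π, k)`. -/
def HeckeAlgebra (b : SimpleRoots P) (k : Parameter b) : Type u := RingQuot (Rel b k)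

variable {b : SimpleRoots P} {k : Parameter b}

noncomputable instance : Ring (HeckeAlgebra b k) := inferInstanceAs (Ring (RingQuot (Rel b k)))

noncomputable instance : Algebra ℂ (HeckeAlgebra b k) :=
  inferInstanceAs (Algebra ℂ (RingQuot (Rel b k)))

namespace HeckeAlgebra

/-- The quotient map from the free algebra. -/
noncomputable def mk (b : SimpleRoots P) (k : Parameter b) : Free P →ₐ[ℂ] HeckeAlgebra b k :=
  RingQuot.mkAlgHom ℂ (Rel b k)

theorem mk_rel {x y : Free P} (h : Rel b k x y) : mk b k x = mk b k y :=
  RingQuot.mkAlgHom_rel ℂ h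

/-- The generators `t_w`, as a multiplicative map. -/
noncomputable def t (b : SimpleRoots P) (k : Parameter b) :
    reflectionGroup P →* HeckeAlgebra b k where
  toFun w := mk b k (freeT w)
  map_one' := (mk_rel Rel.t_one).trans (map_one _)
  map_mul' w w' := (mk_rel (Rel.t_mul w w')).trans (map_mul _ _ _)

/-- The generators `f_v`, as a linear map. -/
noncomputable def f (b : SimpleRoots P) (k : Parameter b) :
    (ℂ ⊗[ℝ] V₀) →ₗ[ℂ] HeckeAlgebra b k where
  toFun v := mk b k (freeF P v)
  map_add' v v' := (mk_rel (Rel.f_add v v')).trans (map_add _ _ _)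
  map_smul' z v := (mk_rel (Rel.f_smul z v)).trans (map_smul _ _ _)

theorem f_comm (v v' : ℂ ⊗[ℝ] V₀) : f b k v * f b k v' = f b k v' * f b k v := by
  have := mk_rel (k := k) (Rel.f_comm v v')
  rwa [map_mul, map_mul] at this

theorem cross (α : b.support) (v : ℂ ⊗[ℝ] V₀) :
    t b k (refl P α) * f b k v - f b k (act (refl P α) v) * t b k (refl P α) =
      algebraMap ℂ (HeckeAlgebra b k) (k.toFun α * corootC P α v) := by
  have := mk_rel (k := k) (Rel.cross α v)
  rwa [map_sub, map_mul, map_mul, AlgHom.commutes] at this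

/-- The universal property of the presentation. -/
noncomputable def lift {B : Type*} [Ring B] [Algebra ℂ B] (τ : reflectionGroup P →* B)
    (φ : (ℂ ⊗[ℝ] V₀) →ₗ[ℂ] B) (hφ : ∀ v v', φ v * φ v' = φ v' * φ v)
    (hc : ∀ (α : b.support) (v : ℂ ⊗[ℝ] V₀),
      τ (refl P α) * φ v - φ (act (refl P α) v) * τ (refl P α) =
        algebraMap ℂ B (k.toFun α * corootC P α v)) :
    HeckeAlgebra b k →ₐ[ℂ] B :=
  RingQuot.liftAlgHom ℂ ⟨FreeAlgebra.lift ℂ (Sum.elim τ φ), by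
    intro x y h
    cases h with
    | t_one => simp [freeT]
    | t_mul w w' => simp [freeT]
    | f_add v v' => simp [freeF]
    | f_smul z v => simp [freeF]
    | f_comm v v' => simpa [freeF] using hφ v v'
    | cross α v => simpa [freeT, freeF, AlgHom.commutes] using hc α v⟩

theorem lift_t {B : Type*} [Ring B] [Algebra ℂ B] (τ : reflectionGroup P →* B)
    (φ : (ℂ ⊗[ℝ] V₀) →ₗ[ℂ] B) (hφ) (hc) (w : reflectionGroup P) :
    lift (b := b) (k := k) τ φ hφ hc (t b k w) = τ w := by
  change RingQuot.liftAlgHom ℂ _ (RingQuot.mkAlgHom ℂ (Rel b k) (freeT w)) = _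
  rw [RingQuot.liftAlgHom_mkAlgHom_apply]
  simp [freeT]

theorem lift_f {B : Type*} [Ring B] [Algebra ℂ B] (τ : reflectionGroup P →* B)
    (φ : (ℂ ⊗[ℝ] V₀) →ₗ[ℂ] B) (hφ) (hc) (v : ℂ ⊗[ℝ] V₀) :
    lift (b := b) (k := k) τ φ hφ hc (f b k v) = φ v := by
  change RingQuot.liftAlgHom ℂ _ (RingQuot.mkAlgHom ℂ (Rel b k) (freeF P v)) = _
  rw [RingQuot.liftAlgHom_mkAlgHom_apply]
  simp [freeF]

theorem induction {p : HeckeAlgebra b k → Prop} (halg : ∀ z, p (algebraMap ℂ _ z))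
    (ht : ∀ w, p (t b k w)) (hf : ∀ v, p (f b k v)) (hmul : ∀ x y, p x → p y → p (x * y))
    (hadd : ∀ x y, p x → p y → p (x + y)) (x : HeckeAlgebra b k) : p x := by
  obtain ⟨y, rfl⟩ := RingQuot.mkAlgHom_surjective ℂ (Rel b k) x
  change p (mk b k y)
  induction y using FreeAlgebra.induction with
  | grade0 z => rw [AlgHom.commutes]; exact halg z
  | grade1 x =>
    cases x with
    | inl w => exact ht w
    | inr v => exact hf v
  | mul x y hx hy => rw [map_mul]; exact hmul _ _ hx hy
  | add x y hx hy => rw [map_add]; exact hadd _ _ hx hy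

/-- The sign character `w ↦ det w` of the reflection group, with complex values. -/
noncomputable def sgn (P : RootPairing ι ℝ V₀ N) : reflectionGroup P →* ℂ where
  toFun w := ((LinearMap.det (w.1 : V₀ →ₗ[ℝ] V₀) : ℝ) : ℂ)
  map_one' := by
    have : (((1 : reflectionGroup P).1 : V₀ →ₗ[ℝ] V₀)) = LinearMap.id := rfl
    rw [this, LinearMap.det_id, Complex.ofReal_one]
  map_mul' w w' := by
    have : (((w * w').1 : V₀ →ₗ[ℝ] V₀)) = (w.1 : V₀ →ₗ[ℝ] V₀) ∘ₗ (w'.1 : V₀ →ₗ[ℝ] V₀) := rfl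
    rw [this, LinearMap.det_comp, Complex.ofReal_mul]

theorem sgn_refl (i : ι) : sgn P (refl P i) = -1 := by
  have hr : Module.IsReflexive ℝ V₀ := .of_isPerfPair P.toLinearMap
  have h : ((refl P i).1 : V₀ →ₗ[ℝ] V₀) = LinearMap.transvection (P.coroot' i) (-P.root i) := by
    ext v
    change P.reflection i v = _
    rw [P.reflection_apply, LinearMap.transvection.apply, smul_neg, sub_eq_add_neg]
  change ((LinearMap.det ((refl P i).1 : V₀ →ₗ[ℝ] V₀) : ℝ) : ℂ) = -1
  rw [h, LinearMap.transvection.det, map_neg]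
  simp
  norm_num

/-- The Iwahori–Matsumoto involution: `ι(v) = -v`, `ι(t_w) = sgn(w) t_w`. -/
noncomputable def iota (b : SimpleRoots P) (k : Parameter b) :
    HeckeAlgebra b k →ₐ[ℂ] HeckeAlgebra b k :=
  lift
    { toFun := fun w => sgn P w • t b k w
      map_one' := by rw [map_one, map_one, one_smul]
      map_mul' := fun w w' => by rw [map_mul, map_mul, smul_mul_smul_comm] }
    (-f b k)
    (fun v v' => by simpa using f_comm v v')
    (fun α v => by
      rw [← cross]
      simp [sgn_refl])

theorem iota_t (w : reflectionGroup P) : iota b k (t b k w) = sgn P w • t b k w :=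
  lift_t _ _ _ _ w

theorem iota_f (v : ℂ ⊗[ℝ] V₀) : iota b k (f b k v) = -f b k v :=
  lift_f _ _ _ _ v

/-- The linear anti-involution `•`: `v^• = v`, `t_w^• = t_w⁻¹`. -/
noncomputable def bullet (b : SimpleRoots P) (k : Parameter b) :
    HeckeAlgebra b k →ₐ[ℂ] (HeckeAlgebra b k)ᵐᵒᵖ :=
  lift
    { toFun := fun w => MulOpposite.op (t b k w⁻¹)
      map_one' := by rw [inv_one, map_one, MulOpposite.op_one]
      map_mul' := fun w w' => by rw [mul_inv_rev, map_mul, MulOpposite.op_mul] }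
    ((MulOpposite.opLinearEquiv ℂ).toLinearMap ∘ₗ f b k)
    (fun v v' => congrArg MulOpposite.op (f_comm v' v))
    (fun α v => by
      have h := cross (k := k) α (act (refl P α) v)
      rw [act_refl_refl, corootC_refl, mul_neg, map_neg] at h
      change MulOpposite.op (f b k v * t b k (refl P α)⁻¹ -
        t b k (refl P α)⁻¹ * f b k (act (refl P α) v)) = MulOpposite.op _
      rw [refl_inv]
      congr 1
      rw [← neg_sub, h, neg_neg])

theorem bullet_t (w : reflectionGroup P) : bullet b k (t b k w) = MulOpposite.op (t b k w⁻¹) :=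
  lift_t _ _ _ _ w

theorem bullet_f (v : ℂ ⊗[ℝ] V₀) : bullet b k (f b k v) = MulOpposite.op (f b k v) :=
  lift_f _ _ _ _ v

variable [Finite ι] [P.IsReduced]

theorem cross_longest (α : b.support) (v : ℂ ⊗[ℝ] V₀) :
    t b k (b.longest * refl P α * b.longest⁻¹) * f b k (-act b.longest v) -
      f b k (-act b.longest (act (refl P α) v)) * t b k (b.longest * refl P α * b.longest⁻¹) =
    algebraMap ℂ (HeckeAlgebra b k) (k.toFun α * corootC P α v) := by
  obtain ⟨β, hβ, h⟩ := exists_neg_longest b α.2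
  have h1 : P.root β = (b.longest * refl P α).1 (P.root α) := by
    change P.root β = b.longest.1 (P.reflection α (P.root α))
    rw [P.reflection_apply_self, map_neg, h]
  have h2 : b.longest * refl P α * b.longest⁻¹ = refl P β := by
    rw [← mul_refl_mul_inv _ h1]
    group
  have h3 : k.toFun α = k.toFun ⟨β, hβ⟩ := k.invariant α ⟨β, hβ⟩ _ h1.symm
  have h4 : corootC P α v = corootC P β (-act b.longest v) := by
    rw [← neg_neg (corootC P α v), ← corootC_refl, ← corootC_act _ h1, act_mul, act_refl_refl,
      map_neg]
  have h5 : act b.longest (act (refl P α) v) = act (refl P β) (act b.longest v) := by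
    rw [← act_mul, ← act_mul, ← h2, inv_mul_cancel_right]
  rw [h2, h3, h4, h5, ← map_neg (act (refl P β))]
  exact cross ⟨β, hβ⟩ _

/-- The involution `θ`: `θ(v) = -w₀(v)`, `θ(t_w) = t_{w₀ w w₀⁻¹}`. -/
noncomputable def theta (b : SimpleRoots P) (k : Parameter b) :
    HeckeAlgebra b k →ₐ[ℂ] HeckeAlgebra b k :=
  lift ((t b k).comp (MulAut.conj b.longest).toMonoidHom) (f b k ∘ₗ (-act b.longest))
    (fun _ _ => f_comm _ _)
    (fun α v => cross_longest α v)

theorem theta_t (w : reflectionGroup P) :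
    theta b k (t b k w) = t b k (b.longest * w * b.longest⁻¹) :=
  lift_t _ _ _ _ w

theorem theta_f (v : ℂ ⊗[ℝ] V₀) : theta b k (f b k v) = f b k (-act b.longest v) :=
  lift_f _ _ _ _ v

/-- The linear anti-involution `*`: `v^* = t_{w₀} θ(v) t_{w₀}⁻¹`, `t_w^* = t_w⁻¹`. -/
noncomputable def star (b : SimpleRoots P) (k : Parameter b) :
    HeckeAlgebra b k →ₐ[ℂ] (HeckeAlgebra b k)ᵐᵒᵖ :=
  lift
    { toFun := fun w => MulOpposite.op (t b k w⁻¹)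
      map_one' := by rw [inv_one, map_one, MulOpposite.op_one]
      map_mul' := fun w w' => by rw [mul_inv_rev, map_mul, MulOpposite.op_mul] }
    { toFun := fun v =>
        MulOpposite.op (t b k b.longest * theta b k (f b k v) * t b k b.longest⁻¹)
      map_add' := fun v v' => by
        rw [map_add, map_add, mul_add, add_mul, MulOpposite.op_add]
      map_smul' := fun z v => by
        rw [map_smul, map_smul, mul_smul_comm, smul_mul_assoc, MulOpposite.op_smul,
          RingHom.id_apply] }
    (fun v v' => by
      have h : t b k b.longest⁻¹ * t b k b.longest = 1 := by
        rw [← map_mul, inv_mul_cancel, map_one]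
      have key : ∀ x y : HeckeAlgebra b k, t b k b.longest * x * t b k b.longest⁻¹ *
          (t b k b.longest * y * t b k b.longest⁻¹) =
          t b k b.longest * (x * y) * t b k b.longest⁻¹ := by
        intro x y
        calc _ = t b k b.longest * x * (t b k b.longest⁻¹ * t b k b.longest) * y *
              t b k b.longest⁻¹ := by noncomm_ring
          _ = _ := by rw [h]; noncomm_ring
      change MulOpposite.op (t b k b.longest * theta b k (f b k v') * t b k b.longest⁻¹ *
          (t b k b.longest * theta b k (f b k v) * t b k b.longest⁻¹)) =
        MulOpposite.op (t b k b.longest * theta b k (f b k v) * t b k b.longest⁻¹ *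
          (t b k b.longest * theta b k (f b k v') * t b k b.longest⁻¹))
      rw [key, key, ← map_mul (theta b k), ← map_mul (theta b k), f_comm])
    (fun α v => by
      have h := cross_longest (k := k) α (act (refl P α) v)
      rw [act_refl_refl, corootC_refl, mul_neg,
        map_neg (algebraMap ℂ (HeckeAlgebra b k)), ← theta_f, ← theta_f] at h
      have h1 : t b k b.longest⁻¹ * t b k (refl P α) =
          t b k (b.longest * refl P α * b.longest⁻¹) * t b k b.longest⁻¹ := by
        rw [← map_mul, ← map_mul, longest_inv, mul_assoc _ b.longest b.longest, longest_mul_self,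
          mul_one]
      have h2 : t b k (refl P α) * t b k b.longest =
          t b k b.longest * t b k (b.longest * refl P α * b.longest⁻¹) := by
        rw [← map_mul, ← map_mul, longest_inv, ← mul_assoc, ← mul_assoc, longest_mul_self,
          one_mul]
      have h3 : t b k b.longest * t b k b.longest⁻¹ = 1 := by
        rw [← map_mul, mul_inv_cancel, map_one]
      change MulOpposite.op (t b k b.longest * theta b k (f b k v) * t b k b.longest⁻¹ *
          t b k (refl P α)⁻¹ - t b k (refl P α)⁻¹ * (t b k b.longest *
          theta b k (f b k (act (refl P α) v)) * t b k b.longest⁻¹)) = MulOpposite.op _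
      rw [refl_inv]
      congr 1
      rw [mul_assoc _ _ (t b k (refl P α)), h1, ← mul_assoc (t b k (refl P α)),
        ← mul_assoc (t b k (refl P α)), h2]
      set S := t b k (b.longest * refl P α * b.longest⁻¹)
      calc _ = t b k b.longest * (-(S * theta b k (f b k (act (refl P α) v)) -
            theta b k (f b k v) * S)) * t b k b.longest⁻¹ := by noncomm_ring
        _ = _ := by
          rw [h, neg_neg, ← Algebra.commutes, mul_assoc, h3, mul_one])

theorem star_t (w : reflectionGroup P) : star b k (t b k w) = MulOpposite.op (t b k w⁻¹) :=
  lift_t _ _ _ _ w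

theorem star_f (v : ℂ ⊗[ℝ] V₀) : star b k (f b k v) =
    MulOpposite.op (t b k b.longest * theta b k (f b k v) * t b k b.longest⁻¹) :=
  lift_f _ _ _ _ v

end HeckeAlgebra

end Algebra


section Modules

/-- A finite-dimensional module over a complex algebra. -/
structure FDModule (A : Type u) [Ring A] [Algebra ℂ A] : Type (u + 1) where
  /-- the underlying space -/
  carrier : Type u
  [addCommGroup : AddCommGroup carrier]
  [moduleC : Module ℂ carrier]
  [module : Module A carrier]
  [isScalarTower : IsScalarTower ℂ A carrier]
  [finiteDimensional : FiniteDimensional ℂ carrier]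

namespace FDModule

attribute [instance] addCommGroup moduleC module isScalarTower finiteDimensional

variable {A : Type u} [Ring A] [Algebra ℂ A]

/-- The twist `φ(X)` of a module by an algebra endomorphism: the same space, with `h` acting as
`φ(h)`. -/
@[reducible] noncomputable def twist (φ : A →ₐ[ℂ] A) (X : FDModule A) : FDModule A :=
  have h : ∀ (z : ℂ) (a : A) (x : X.carrier), φ (z • a) • x = z • φ a • x := fun z a x => by
    rw [map_smul, smul_assoc]
  letI m : Module A X.carrier := Module.compHom X.carrier φ.toRingHom
  { carrier := X.carrier
    module := m
    isScalarTower := ⟨h⟩ }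

/-- The dual of a module with respect to an algebra anti-endomorphism `σ`: the space of linear
functionals, with `(h · f)(x) = f(σ(h) · x)`. -/
@[reducible] noncomputable def dual (σ : A →ₐ[ℂ] Aᵐᵒᵖ) (X : FDModule A) : FDModule A :=
  letI m : Module A (Module.Dual ℂ X.carrier) :=
    { smul := fun h f => f ∘ₗ Algebra.lsmul ℂ ℂ X.carrier (MulOpposite.unop (σ h))
      one_smul := fun f => by
        ext x
        change f (MulOpposite.unop (σ 1) • x) = f x
        rw [map_one, MulOpposite.unop_one, one_smul]
      mul_smul := fun h h' f => by
        ext x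
        change f (MulOpposite.unop (σ (h * h')) • x) =
          f (MulOpposite.unop (σ h') • MulOpposite.unop (σ h) • x)
        rw [map_mul, MulOpposite.unop_mul, mul_smul]
      smul_zero := fun h => rfl
      smul_add := fun h f g => rfl
      add_smul := fun h h' f => by
        ext x
        change f (MulOpposite.unop (σ (h + h')) • x) =
          f (MulOpposite.unop (σ h) • x) + f (MulOpposite.unop (σ h') • x)
        rw [map_add, MulOpposite.unop_add, add_smul, map_add]
      zero_smul := fun f => by
        ext x
        change f (MulOpposite.unop (σ 0) • x) = 0
        rw [map_zero, MulOpposite.unop_zero, zero_smul, map_zero] }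
  { carrier := Module.Dual ℂ X.carrier
    module := m
    isScalarTower := ⟨fun z a f => by
      ext x
      change f (MulOpposite.unop (σ (z • a)) • x) = z • f (MulOpposite.unop (σ a) • x)
      rw [map_smul σ, MulOpposite.unop_smul, smul_assoc, LinearMap.map_smul f]⟩ }

end FDModule

/-- The relations `[Y] = [X] + [Z]` for short exact sequences `0 → X → Y → Z → 0` of
finite-dimensional modules. -/
def exactRelations (A : Type u) [Ring A] [Algebra ℂ A] : Set (FreeAbelianGroup (FDModule A)) :=
  {z | ∃ (X Y Z : FDModule A) (i : X.carrier →ₗ[A] Y.carrier) (p : Y.carrier →ₗ[A] Z.carrier),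
    Function.Injective i ∧ Function.Exact i p ∧ Function.Surjective p ∧
    z = FreeAbelianGroup.of Y - (FreeAbelianGroup.of X + FreeAbelianGroup.of Z)}

/-- The Grothendieck group of finite-dimensional modules over a complex algebra. -/
abbrev Groth (A : Type u) [Ring A] [Algebra ℂ A] : Type (u + 1) :=
  FreeAbelianGroup (FDModule A) ⧸ AddSubgroup.closure (exactRelations A)

/-- The class `[X]` of a finite-dimensional module in the Grothendieck group. -/
def FDModule.cls {A : Type u} [Ring A] [Algebra ℂ A] (X : FDModule A) : Groth A :=
  QuotientAddGroup.mk (FreeAbelianGroup.of X)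

/-- The `A`-submodule of `A ⊗_ℂ Y` generated by the elements `a c ⊗ y - a ⊗ c y` with `c ∈ B`. -/
def balanced {A : Type u} [Ring A] [Algebra ℂ A] (B : Subalgebra ℂ A) (Y : Type u)
    [AddCommGroup Y] [Module ℂ Y] [Module B Y] : Submodule A (A ⊗[ℂ] Y) :=
  Submodule.span A {z | ∃ (a : A) (c : B) (y : Y), z = (a * c) ⊗ₜ[ℂ] y - a ⊗ₜ[ℂ] (c • y)}

/-- The induced module `A ⊗_B Y`, for a subalgebra `B` of a (noncommutative) algebra `A`. -/
abbrev Ind {A : Type u} [Ring A] [Algebra ℂ A] (B : Subalgebra ℂ A) (Y : Type u)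
    [AddCommGroup Y] [Module ℂ Y] [Module B Y] : Type u :=
  (A ⊗[ℂ] Y) ⧸ balanced B Y

end Modules

section Main

variable {ι N : Type*} {V₀ : Type u} [AddCommGroup V₀] [Module ℝ V₀] [AddCommGroup N] [Module ℝ N]
variable {P : RootPairing ι ℝ V₀ N} {b : SimpleRoots P} {k : Parameter b}

/-- The parabolic subgroup `W_J` generated by the simple reflections in `J`. -/
def parabolic (P : RootPairing ι ℝ V₀ N) (J : Finset ι) : Subgroup (reflectionGroup P) :=
  Subgroup.closure (refl P '' (J : Set ι))

namespace HeckeAlgebra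

/-- The parabolic subalgebra `ℍ_J` generated by all `v ∈ V` and all `t_w` with `w ∈ W_J`. -/
noncomputable def parabolicSubalgebra (b : SimpleRoots P) (k : Parameter b) (J : Finset ι) :
    Subalgebra ℂ (HeckeAlgebra b k) :=
  Algebra.adjoin ℂ (Set.range (f b k) ∪ t b k '' (parabolic P J : Set (reflectionGroup P)))

theorem f_mem (J : Finset ι) (v : ℂ ⊗[ℝ] V₀) : f b k v ∈ parabolicSubalgebra b k J :=
  Algebra.subset_adjoin (Or.inl ⟨v, rfl⟩)

variable [Finite ι] [P.IsReduced]

/-- `ℍ` is spanned by the products `t_w a` with `a ∈ ℍ_J`. -/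
theorem span_t_mul (J : Finset ι) :
    Submodule.span ℂ {x : HeckeAlgebra b k | ∃ w, ∃ a ∈ parabolicSubalgebra b k J,
      x = t b k w * a} = ⊤ := by
  set M := Submodule.span ℂ {x : HeckeAlgebra b k | ∃ w, ∃ a ∈ parabolicSubalgebra b k J,
      x = t b k w * a} with hM
  have hmem : ∀ w, ∀ a ∈ parabolicSubalgebra b k J, t b k w * a ∈ M := fun w a ha =>
    Submodule.subset_span ⟨w, a, ha, rfl⟩
  have ht : ∀ w, ∀ x ∈ M, t b k w * x ∈ M := by
    intro w x hx
    induction hx using Submodule.span_induction with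
    | mem x hx =>
      obtain ⟨w', a, ha, rfl⟩ := hx
      rw [← mul_assoc, ← map_mul]
      exact hmem _ _ ha
    | zero => rw [mul_zero]; exact zero_mem _
    | add x y _ _ h1 h2 => rw [mul_add]; exact add_mem h1 h2
    | smul z x _ h => rw [mul_smul_comm]; exact Submodule.smul_mem _ _ h
  have hr : ∀ x ∈ M, ∀ a ∈ parabolicSubalgebra b k J, x * a ∈ M := by
    intro x hx a ha
    induction hx using Submodule.span_induction with
    | mem x hx =>
      obtain ⟨w', a', ha', rfl⟩ := hx
      rw [mul_assoc]
      exact hmem _ _ (mul_mem ha' ha)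
    | zero => rw [zero_mul]; exact zero_mem _
    | add x y _ _ h1 h2 => rw [add_mul]; exact add_mem h1 h2
    | smul z x _ h => rw [smul_mul_assoc]; exact Submodule.smul_mem _ _ h
  have hft : ∀ (w : reflectionGroup P) (v : ℂ ⊗[ℝ] V₀), f b k v * t b k w ∈ M := by
    intro w
    obtain ⟨L, rfl⟩ := exists_list b w
    induction L with
    | nil =>
      intro v
      rw [List.map_nil, List.prod_nil, map_one, mul_one, ← one_mul (f b k v), ← map_one (t b k)]
      exact hmem _ _ (f_mem J v)
    | cons α L ih =>
      intro v
      rw [List.map_cons, List.prod_cons, map_mul, ← mul_assoc]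
      set u := (L.map fun a : b.support => refl P a).prod
      have h := cross (k := k) α (act (refl P α) v)
      rw [act_refl_refl, sub_eq_iff_eq_add] at h
      have h' := eq_sub_of_add_eq' h.symm
      rw [h', sub_mul, mul_assoc, ← Algebra.smul_def]
      refine sub_mem (ht _ _ (ih _)) (Submodule.smul_mem _ _ ?_)
      rw [← mul_one (t b k u)]
      exact hmem _ _ (one_mem _)
  have hf : ∀ (v : ℂ ⊗[ℝ] V₀), ∀ x ∈ M, f b k v * x ∈ M := by
    intro v x hx
    induction hx using Submodule.span_induction with
    | mem x hx =>
      obtain ⟨w', a, ha, rfl⟩ := hx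
      rw [← mul_assoc]
      exact hr _ (hft w' v) _ ha
    | zero => rw [mul_zero]; exact zero_mem _
    | add x y _ _ h1 h2 => rw [mul_add]; exact add_mem h1 h2
    | smul z x _ h => rw [mul_smul_comm]; exact Submodule.smul_mem _ _ h
  have hleft : ∀ h : HeckeAlgebra b k, ∀ x ∈ M, h * x ∈ M := by
    intro h
    induction h using HeckeAlgebra.induction with
    | halg z =>
      intro x hx
      rw [← Algebra.smul_def]
      exact Submodule.smul_mem _ _ hx
    | ht w => exact ht w
    | hf v => exact hf v
    | hmul x y h1 h2 =>
      intro z hz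
      rw [mul_assoc]
      exact h1 _ (h2 _ hz)
    | hadd x y h1 h2 =>
      intro z hz
      rw [add_mul]
      exact add_mem (h1 _ hz) (h2 _ hz)
  have h1 : (1 : HeckeAlgebra b k) ∈ M := by
    have := hmem 1 1 (one_mem _)
    rwa [map_one, one_mul] at this
  rw [eq_top_iff]
  intro x _
  have := hleft x 1 h1
  rwa [mul_one] at this

theorem finite_ind (J : Finset ι) (Y : Type u) [AddCommGroup Y] [Module ℂ Y]
    [Module (parabolicSubalgebra b k J) Y] [FiniteDimensional ℂ Y] :
    FiniteDimensional ℂ (Ind (parabolicSubalgebra b k J) Y) := by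
  classical
  have := finite_reflectionGroup P
  have := Fintype.ofFinite (reflectionGroup P)
  let q : (HeckeAlgebra b k ⊗[ℂ] Y) →ₗ[ℂ] Ind (parabolicSubalgebra b k J) Y :=
    (balanced (parabolicSubalgebra b k J) Y).mkQ.restrictScalars ℂ
  let g : (reflectionGroup P → Y) →ₗ[ℂ] Ind (parabolicSubalgebra b k J) Y :=
    ∑ w, q ∘ₗ TensorProduct.mk ℂ _ Y (t b k w) ∘ₗ LinearMap.proj w
  refine Module.Finite.of_surjective g ?_
  rw [← LinearMap.range_eq_top, eq_top_iff]
  have hg : ∀ w y, q (t b k w ⊗ₜ y) ∈ LinearMap.range g := by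
    intro w y
    refine ⟨Pi.single w y, ?_⟩
    simp only [g, LinearMap.sum_apply, LinearMap.comp_apply, LinearMap.proj_apply,
      TensorProduct.mk_apply]
    rw [Finset.sum_eq_single w]
    · rw [Pi.single_eq_same]
    · intro w' _ hne
      rw [Pi.single_eq_of_ne hne, TensorProduct.tmul_zero, map_zero]
    · intro h
      exact absurd (Finset.mem_univ w) h
  have hall : ∀ (h : HeckeAlgebra b k) (y : Y), q (h ⊗ₜ y) ∈ LinearMap.range g := by
    intro h y
    have hh : h ∈ Submodule.span ℂ {x : HeckeAlgebra b k | ∃ w,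
        ∃ a ∈ parabolicSubalgebra b k J, x = t b k w * a} := by
      rw [span_t_mul]; trivial
    induction hh using Submodule.span_induction with
    | mem x hx =>
      obtain ⟨w, a, ha, rfl⟩ := hx
      have : q ((t b k w * a) ⊗ₜ y) =
          q (t b k w ⊗ₜ ((⟨a, ha⟩ : parabolicSubalgebra b k J) • y)) :=
        (Submodule.Quotient.eq _).mpr (Submodule.subset_span ⟨t b k w, ⟨a, ha⟩, y, rfl⟩)
      rw [this]
      exact hg _ _
    | zero => rw [TensorProduct.zero_tmul, map_zero]; exact zero_mem _
    | add x x' _ _ h1 h2 => rw [TensorProduct.add_tmul, map_add]; exact add_mem h1 h2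
    | smul z x _ h1 =>
      rw [← TensorProduct.smul_tmul', map_smul]
      exact Submodule.smul_mem _ _ h1
  intro z _
  obtain ⟨z, rfl⟩ := (balanced (parabolicSubalgebra b k J) Y).mkQ_surjective z
  change q z ∈ _
  induction z with
  | zero => rw [map_zero]; exact zero_mem _
  | tmul h y => exact hall h y
  | add x y h1 h2 =>
    rw [map_add]
    exact add_mem (h1 trivial) (h2 trivial)

/-- The module `Ind_{ℍ_J}^ℍ Res_{ℍ_J} X = ℍ ⊗_{ℍ_J} X`. -/
@[reducible] noncomputable def indRes (J : Finset ι) (X : FDModule (HeckeAlgebra b k)) :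
    FDModule (HeckeAlgebra b k) :=
  { carrier := Ind (parabolicSubalgebra b k J) X.carrier
    finiteDimensional := finite_ind J X.carrier }

/-- The dual `𝔻(X) = ι(X^•)^*`. -/
noncomputable def D (X : FDModule (HeckeAlgebra b k)) : FDModule (HeckeAlgebra b k) :=
  ((X.dual (bullet b k)).twist (iota b k)).dual (star b k)

end HeckeAlgebra

end Main

end GradedHecke

/-!
# Duality for the graded affine Hecke algebra

*Induced modules.* For an `ℍ`-module `X`, the module `ℍ ⊗_{ℍ_J} X` is realised on the functions
`W / W_J → X`, with the function supported at `w W_J` of value `x` in the role of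
`t_w ⊗ t_w⁻¹ x` (`Model`, `Model.ofInd_bijective`). On it `t_u` translates the cosets and acts on
the values, and the action of `v ∈ V` is given by an explicit sum over the inversions of `w`. The cross relations follow from the
comparison of the inversions of `w` and `s_α w`; they in turn reduce the commutativity of the
action of `V` to the functions supported at the trivial coset. In particular `X ↦ ℍ ⊗_{ℍ_J} X`
is exact, so the alternating sum over `J` is an endomorphism of the Grothendieck group
(`alternatingInd`).

*Inclusion-exclusion.* Let `M` be the model for `J = ∅` and `N_α` the kernel of `M → Model {α}`,
for `α ∈ Π`. The model for `J` is the quotient of `M` by the sum of the `N_α` with `α ∈ J`. All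
these kernels are spanned by parts of one basis: the elements `b_w = ∑ sgn(u) w u`, with `u`
running over the parabolic subgroup generated by the right descents of `w`, form a basis of
`ℂ[W]` by unitriangularity for the length, and `b_w ⊗ x` belongs to the kernel for `J` exactly
if a descent of `w` lies in `J` (`Model.proj_altSum_eq_zero_iff`). So the `N_α` generate a
distributive lattice of submodules (`Model.exists_proj_eq`), and inclusion-exclusion shows that
the alternating sum of the classes of the models is the class of the intersection of all the
`N_α` (`sum_cls_indRes`).

*The dual.* This intersection is the set of the elements `∑ sgn(w) t_w ⊗ t_w⁻¹ x` with `x ∈ X`.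
On it `ℍ` acts through the twist `t_w ↦ sgn(w) t_w`, `v ↦ t_{w₀} w₀(v) t_{w₀}⁻¹`
(`Model.signEmb_smul`), which is the composition of the three involutions in the definition of
`𝔻(X)`. Therefore the equality holds for all finite-dimensional modules (`cls_D_eq`).

*Finiteness.* An irreducible module is finitely generated over the commutative algebra generated
by `V`. So by the Nullstellensatz it has a nonzero finite-dimensional quotient over this
algebra, and it embeds into the module coinduced from this quotient
(`finiteDimensional_of_isSimpleModule`).
-/

namespace GradedHecke

/-! ### Inversions and parabolic subgroups -/

section Combinatorics

variable {ι N : Type*} {V₀ : Type u} [AddCommGroup V₀] [Module ℝ V₀] [AddCommGroup N] [Module ℝ N]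
variable {P : RootPairing ι ℝ V₀ N} (b : SimpleRoots P)

/-- The root of index `i` is positive and is sent to a negative root by `w⁻¹`. -/
def IsInversion (w : reflectionGroup P) (i : ι) : Prop :=
  P.root i ∈ b.posRoots ∧ -((w⁻¹).1 (P.root i)) ∈ b.posRoots

theorem inv_apply_apply (w : reflectionGroup P) (x : V₀) : (w⁻¹).1 (w.1 x) = x := by
  change (w⁻¹ * w).1 x = x
  rw [inv_mul_cancel]; rfl

/-- The nonnegative combinations of the simple roots. -/
def SimpleRoots.IsNonneg (x : V₀) : Prop :=
  ∃ c : ι → ℝ, (∀ a, 0 ≤ c a) ∧ x = ∑ a ∈ b.support, c a • P.root a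

variable {b}

theorem SimpleRoots.IsNonneg.sum {S : Finset ι} {c : ι → ℝ} {x : ι → V₀} (hc : ∀ a ∈ S, 0 ≤ c a)
    (hx : ∀ a ∈ S, b.IsNonneg (x a)) : b.IsNonneg (∑ a ∈ S, c a • x a) := by
  choose! d hd hd' using hx
  refine ⟨fun a => ∑ α ∈ S, c α * d α a,
    fun a => Finset.sum_nonneg fun α hα => mul_nonneg (hc α hα) (hd α hα a), ?_⟩
  simp only [Finset.sum_smul, mul_smul]
  rw [Finset.sum_comm]
  refine Finset.sum_congr rfl fun α hα => ?_
  rw [← Finset.smul_sum, ← hd' α hα]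

/-- A linear map that sends the simple roots in `J` to nonnegative vectors sends every positive
root in the span of `J` to a nonnegative vector. -/
theorem isNonneg_of_mem_span {J : Finset ι} (hJ : J ⊆ b.support) {x : V₀} (hx : x ∈ b.posRoots)
    (hxJ : x ∈ Submodule.span ℝ (P.root '' (J : Set ι))) (g : V₀ →ₗ[ℝ] V₀)
    (hg : ∀ α ∈ J, b.IsNonneg (g (P.root α))) : b.IsNonneg (g x) := by
  classical
  obtain ⟨-, c, hc, hc'⟩ := hx
  rw [Submodule.mem_span_image_finset_iff_exists_fun] at hxJ
  obtain ⟨d, hd⟩ : ∃ d : ι → ℝ, ∑ a ∈ J, d a • P.root a = x := by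
    obtain ⟨d, hd⟩ := hxJ
    refine ⟨fun a => if h : a ∈ J then d ⟨a, h⟩ else 0, ?_⟩
    rw [← hd, ← Finset.sum_coe_sort]
    simp
  have h1 : ∑ a ∈ b.support, c a • P.root a =
      ∑ a ∈ b.support, (fun a => if a ∈ J then d a else 0) a • P.root a := by
    rw [← hc', ← hd]
    simp only [ite_smul, zero_smul]
    rw [← Finset.sum_filter, Finset.filter_mem_eq_inter, Finset.inter_eq_right.mpr hJ]
  have h2 := coeff_unique b h1
  have h3 : x = ∑ a ∈ J, d a • P.root a := hd.symm
  rw [h3, map_sum]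
  simp only [map_smul]
  refine SimpleRoots.IsNonneg.sum (fun a ha => ?_) hg
  have := h2 a (hJ ha)
  simp only [ha, if_true] at this
  exact this ▸ hc a

theorem apply_mem_span {J : Finset ι} {u : reflectionGroup P} (hu : u ∈ parabolic P J) {x : V₀}
    (hx : x ∈ Submodule.span ℝ (P.root '' (J : Set ι))) :
    u.1 x ∈ Submodule.span ℝ (P.root '' (J : Set ι)) := by
  have step : ∀ α ∈ J, ∀ x ∈ Submodule.span ℝ (P.root '' (J : Set ι)),
      (refl P α).1 x ∈ Submodule.span ℝ (P.root '' (J : Set ι)) := by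
    intro α hα x hx
    change P.reflection α x ∈ _
    rw [P.reflection_apply]
    exact sub_mem hx (Submodule.smul_mem _ _ (Submodule.subset_span ⟨α, hα, rfl⟩))
  induction hu using Subgroup.closure_induction_left with
  | one => exact hx
  | mul_left y hy z hz ih =>
    obtain ⟨α, hα, rfl⟩ := hy
    exact step α hα _ ih
  | inv_mul_cancel y hy z hz ih =>
    obtain ⟨α, hα, rfl⟩ := hy
    rw [refl_inv]
    exact step α hα _ ih

/-- The positive roots made negative by an element of `W_J` lie in the span of `J`, and their
reflections lie in `W_J`. -/
theorem mem_span_of_neg [P.IsReduced] {J : Finset ι} (hJ : J ⊆ b.support) {u : reflectionGroup P}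
    (hu : u ∈ parabolic P J) {i : ι} (hi : P.root i ∈ b.posRoots)
    (hn : -(u.1 (P.root i)) ∈ b.posRoots) :
    P.root i ∈ Submodule.span ℝ (P.root '' (J : Set ι)) ∧ refl P i ∈ parabolic P J := by
  have step : ∀ α ∈ J, ∀ z ∈ parabolic P J,
      (-(z.1 (P.root i)) ∈ b.posRoots →
        P.root i ∈ Submodule.span ℝ (P.root '' (J : Set ι)) ∧ refl P i ∈ parabolic P J) →
      -((refl P α * z).1 (P.root i)) ∈ b.posRoots →
        P.root i ∈ Submodule.span ℝ (P.root '' (J : Set ι)) ∧ refl P i ∈ parabolic P J := by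
    intro α hα z hz ih hn
    rcases mem_or_neg_mem b (apply_mem_range z hi.1) with h | h
    swap
    · exact ih h
    by_cases h2 : z.1 (P.root i) = P.root α
    swap
    · exact absurd hn (neg_notMem b (refl_mem b h (hJ hα) h2))
    constructor
    · rw [← inv_apply_apply z (P.root i), h2]
      exact apply_mem_span (inv_mem hz) (Submodule.subset_span ⟨α, hα, rfl⟩)
    · have h3 := mul_refl_mul_inv z h2.symm
      have h4 : refl P i = z⁻¹ * refl P α * z := by rw [← h3]; group
      rw [h4]
      exact mul_mem (mul_mem (inv_mem hz) (Subgroup.subset_closure ⟨α, hα, rfl⟩)) hz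
  induction hu using Subgroup.closure_induction_left with
  | one => exact absurd hn (neg_notMem b hi)
  | mul_left y hy z hz ih =>
    obtain ⟨α, hα, rfl⟩ := hy
    exact step α hα z hz ih hn
  | inv_mul_cancel y hy z hz ih =>
    obtain ⟨α, hα, rfl⟩ := hy
    rw [refl_inv] at hn
    exact step α hα z hz ih hn

/-- The inversions of two elements of the same coset `w W_J` differ only by reflections that fix
this coset. -/
theorem refl_mul_coset [P.IsReduced] {J : Finset ι} (hJ : J ⊆ b.support) {w w' : reflectionGroup P}
    (h : (w : reflectionGroup P ⧸ parabolic P J) = w') {i : ι} (hi : IsInversion b w i)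
    (hi' : ¬ IsInversion b w' i) : ((refl P i * w : reflectionGroup P) :
      reflectionGroup P ⧸ parabolic P J) = w := by
  rw [QuotientGroup.eq] at h
  obtain ⟨j, hj, -⟩ := exists_root w⁻¹ i
  have hr : P.root (P.reflectionPerm j j) = -P.root j := by simp
  have h1 : P.root (P.reflectionPerm j j) ∈ b.posRoots := by
    rw [hr, hj]; exact hi.2
  have h2 : -((w⁻¹ * w')⁻¹.1 (P.root (P.reflectionPerm j j))) ∈ b.posRoots := by
    rw [hr, hj, map_neg, neg_neg]
    have : ((w⁻¹ * w')⁻¹).1 ((w⁻¹).1 (P.root i)) = (w'⁻¹).1 (P.root i) := by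
      change ((w⁻¹ * w')⁻¹ * w⁻¹).1 _ = _
      congr 2
      group
    rw [this]
    rcases mem_or_neg_mem b (apply_mem_range w'⁻¹ hi.1.1) with h3 | h3
    · exact h3
    · exact absurd ⟨hi.1, h3⟩ hi'
  have h3 := (mem_span_of_neg hJ (inv_mem h) h1 h2).2
  rw [refl_perm_self] at h3
  rw [eq_comm, QuotientGroup.eq]
  have h4 := mul_refl_mul_inv w⁻¹ hj
  rw [inv_inv] at h4
  rwa [← mul_assoc, h4]

variable (b)

theorem length_lt_mul_refl [Finite ι] [P.IsReduced] (w : reflectionGroup P) {α : ι}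
    (hα : α ∈ b.support) (h : w.1 (P.root α) ∈ b.posRoots) :
    b.length w < b.length (w * refl P α) := by
  have hfin : {x : V₀ | x ∈ b.posRoots ∧ -((w * refl P α).1 x) ∈ b.posRoots}.Finite :=
    (finite_posRoots b).subset fun x hx => hx.1
  have himg : P.reflection α '' {x : V₀ | x ∈ b.posRoots ∧ -(w.1 x) ∈ b.posRoots} ⊂
      {x : V₀ | x ∈ b.posRoots ∧ -((w * refl P α).1 x) ∈ b.posRoots} := by
    refine (Set.ssubset_iff_of_subset ?_).mpr ⟨P.root α, ⟨simple_mem b hα, ?_⟩, ?_⟩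
    · rintro _ ⟨x, ⟨hx, hx'⟩, rfl⟩
      have hne : x ≠ P.root α := by
        rintro rfl
        exact neg_notMem b h hx'
      refine ⟨refl_mem b hx hα hne, ?_⟩
      change -(w.1 (P.reflection α (P.reflection α x))) ∈ _
      rwa [P.reflection_same]
    · change -(w.1 (P.reflection α (P.root α))) ∈ _
      rwa [P.reflection_apply_self, map_neg, neg_neg]
    · rintro ⟨x, ⟨hx, -⟩, hx'⟩
      have : x = -P.root α := by
        rw [← P.reflection_same α x, hx', P.reflection_apply_self]
      rw [this] at hx
      exact neg_notMem b (simple_mem b hα) hx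
  have h1 := Set.ncard_lt_ncard himg hfin
  rwa [Set.ncard_image_of_injective _ (P.reflection α).injective] at h1

theorem length_mul_refl_lt [Finite ι] [P.IsReduced] (w : reflectionGroup P) {α : ι}
    (hα : α ∈ b.support) (h : -(w.1 (P.root α)) ∈ b.posRoots) :
    b.length (w * refl P α) < b.length w := by
  have h1 := length_lt_mul_refl b (w * refl P α) hα (by
    change w.1 (P.reflection α (P.root α)) ∈ _
    rwa [P.reflection_apply_self, map_neg])
  rwa [mul_assoc, refl_mul_self, mul_one] at h1

theorem mem_posRoots_of_isNonneg {x : V₀} (hx : x ∈ Set.range P.root) (h : b.IsNonneg x) :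
    x ∈ b.posRoots := ⟨hx, h⟩

/-- A nontrivial element of `W_J` makes some simple root in `J` negative. -/
theorem exists_descent [Finite ι] [P.IsReduced] {J : Finset ι} (hJ : J ⊆ b.support)
    {u : reflectionGroup P} (hu : u ∈ parabolic P J) (h1 : u ≠ 1) :
    ∃ α ∈ J, -(u.1 (P.root α)) ∈ b.posRoots := by
  by_contra! hcon
  apply h1
  apply eq_one_of_preserves b
  rintro x hx
  rcases mem_or_neg_mem b (apply_mem_range u hx.1) with h | h
  · exact h
  obtain ⟨i, rfl⟩ := hx.1
  have hs := (mem_span_of_neg hJ hu hx h).1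
  refine mem_posRoots_of_isNonneg b (apply_mem_range u hx.1) ?_
  refine isNonneg_of_mem_span hJ hx hs u.1.toLinearMap fun α hα => ?_
  rcases mem_or_neg_mem b (apply_mem_range u (simple_mem b (hJ hα)).1) with h2 | h2
  · exact h2.2
  · exact absurd h2 (hcon α hα)

/-- If `w` makes the simple roots in `J` positive, then it is the shortest element of `w W_J`. -/
theorem length_lt_of_pos [Finite ι] [P.IsReduced] {J : Finset ι} (hJ : J ⊆ b.support)
    {w : reflectionGroup P} (hw : ∀ α ∈ J, w.1 (P.root α) ∈ b.posRoots)
    {u : reflectionGroup P} (hu : u ∈ parabolic P J) (h1 : u ≠ 1) :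
    b.length w < b.length (w * u) := by
  -- Write `u = u' s_α` with `u' α` positive: then `w u' α` is positive, too.
  induction hn : b.length u using Nat.strong_induction_on generalizing u with
  | _ n ih =>
  obtain ⟨α, hα, hneg⟩ := exists_descent b hJ hu h1
  have hu' : u * refl P α ∈ parabolic P J := mul_mem hu (Subgroup.subset_closure ⟨α, hα, rfl⟩)
  have hle : b.length w ≤ b.length (w * (u * refl P α)) := by
    by_cases h : u * refl P α = 1
    · rw [h, mul_one]
    · exact (ih _ (hn ▸ length_mul_refl_lt b u (hJ hα) hneg) hu' h rfl).le
  have hpos : (u * refl P α).1 (P.root α) ∈ b.posRoots := by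
    change u.1 (P.reflection α (P.root α)) ∈ _
    rwa [P.reflection_apply_self, map_neg]
  have hlt := length_lt_mul_refl b (w * (u * refl P α)) (hJ hα)
    (mem_posRoots_of_isNonneg b (apply_mem_range w hpos.1)
      (isNonneg_of_mem_span hJ hpos (apply_mem_span hu' (Submodule.subset_span ⟨α, hα, rfl⟩))
        w.1.toLinearMap fun β hβ => (hw β hβ).2))
  rw [mul_assoc, mul_assoc, refl_mul_self, mul_one] at hlt
  exact hle.trans_lt hlt

/-- If `w` makes the simple roots in `J` negative, then it is the longest element of `w W_J`. -/
theorem length_lt_of_neg [Finite ι] [P.IsReduced] {J : Finset ι} (hJ : J ⊆ b.support)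
    {w : reflectionGroup P} (hw : ∀ α ∈ J, -(w.1 (P.root α)) ∈ b.posRoots)
    {u : reflectionGroup P} (hu : u ∈ parabolic P J) (h1 : u ≠ 1) :
    b.length (w * u) < b.length w := by
  induction hn : b.length u using Nat.strong_induction_on generalizing u with
  | _ n ih =>
  obtain ⟨α, hα, hneg⟩ := exists_descent b hJ hu h1
  have hu' : u * refl P α ∈ parabolic P J := mul_mem hu (Subgroup.subset_closure ⟨α, hα, rfl⟩)
  have hle : b.length (w * (u * refl P α)) ≤ b.length w := by
    by_cases h : u * refl P α = 1
    · rw [h, mul_one]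
    · exact (ih _ (hn ▸ length_mul_refl_lt b u (hJ hα) hneg) hu' h rfl).le
  have hpos : (u * refl P α).1 (P.root α) ∈ b.posRoots := by
    change u.1 (P.reflection α (P.root α)) ∈ _
    rwa [P.reflection_apply_self, map_neg]
  have hneg' : -((w * (u * refl P α)).1 (P.root α)) ∈ b.posRoots := by
    refine mem_posRoots_of_isNonneg b ?_
      (isNonneg_of_mem_span hJ hpos (apply_mem_span hu' (Submodule.subset_span ⟨α, hα, rfl⟩))
        (-w.1.toLinearMap) fun β hβ => (hw β hβ).2)
    obtain ⟨i, hi⟩ := apply_mem_range w hpos.1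
    exact ⟨P.reflectionPerm i i, by simpa using hi⟩
  have hlt := length_mul_refl_lt b (w * (u * refl P α)) (hJ hα) hneg'
  rw [mul_assoc, mul_assoc, refl_mul_self, mul_one] at hlt
  exact hlt.trans_le hle

end Combinatorics

/-! ### The parameter on all roots and sums over inversions -/

section Coefficients

variable {ι N : Type*} {V₀ : Type u} [AddCommGroup V₀] [Module ℝ V₀] [AddCommGroup N] [Module ℝ N]
variable {P : RootPairing ι ℝ V₀ N} {b : SimpleRoots P} (k : Parameter b)

open Classical in
/-- The extension of the parameter to all roots which is constant on orbits of the reflection group.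
The value `0` on roots which are not conjugate to a simple root is a convention. -/
noncomputable def Parameter.extend (i : ι) : ℂ :=
  if h : ∃ α : b.support, ∃ w : reflectionGroup P, w.1 (P.root α) = P.root i then
    k.toFun h.choose else 0

theorem Parameter.extend_simple (α : b.support) : k.extend (α : ι) = k.toFun α := by
  have h : ∃ β : b.support, ∃ w : reflectionGroup P, w.1 (P.root β) = P.root α := ⟨α, 1, rfl⟩
  rw [Parameter.extend, dif_pos h]
  obtain ⟨w, hw⟩ := h.choose_spec
  exact k.invariant _ _ w hw

theorem Parameter.extend_apply (w : reflectionGroup P) {i j : ι} (h : P.root j = w.1 (P.root i)) :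
    k.extend j = k.extend i := by
  by_cases hi : ∃ β : b.support, ∃ w : reflectionGroup P, w.1 (P.root β) = P.root i
  · have hj : ∃ β : b.support, ∃ w : reflectionGroup P, w.1 (P.root β) = P.root j := by
      obtain ⟨β, y, hy⟩ := hi
      exact ⟨β, w * y, by rw [h, ← hy]; rfl⟩
    rw [Parameter.extend, dif_pos hj, Parameter.extend, dif_pos hi]
    obtain ⟨y, hy⟩ := hi.choose_spec
    obtain ⟨z, hz⟩ := hj.choose_spec
    refine k.invariant _ _ (y⁻¹ * w⁻¹ * z) ?_
    change (y⁻¹).1 ((w⁻¹).1 (z.1 _)) = _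
    rw [hz, h, inv_apply_apply]
    exact (congrArg _ hy.symm).trans (inv_apply_apply y _)
  · have hj : ¬ ∃ β : b.support, ∃ w : reflectionGroup P, w.1 (P.root β) = P.root j := by
      rintro ⟨β, y, hy⟩
      exact hi ⟨β, w⁻¹ * y, by
        change (w⁻¹).1 (y.1 _) = _
        rw [hy, h, inv_apply_apply]⟩
    rw [Parameter.extend, dif_neg hj, Parameter.extend, dif_neg hi]

/-- The functional `k_β ⟨·, β^∨⟩` on `V` attached to a root `β`. -/
noncomputable def Parameter.coef (i : ι) : Module.Dual ℂ (ℂ ⊗[ℝ] V₀) := k.extend i • corootC P i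

theorem Parameter.coef_simple (α : b.support) (v : ℂ ⊗[ℝ] V₀) :
    k.coef α v = k.toFun α * corootC P α v := by
  rw [Parameter.coef, LinearMap.smul_apply, k.extend_simple, smul_eq_mul]

theorem Parameter.coef_act (w : reflectionGroup P) {i j : ι} (h : P.root j = w.1 (P.root i))
    (v : ℂ ⊗[ℝ] V₀) : k.coef j (act w v) = k.coef i v := by
  rw [Parameter.coef, LinearMap.smul_apply, Parameter.coef, LinearMap.smul_apply,
    k.extend_apply w h, corootC_act w h]

theorem Parameter.coef_refl (i : ι) (v : ℂ ⊗[ℝ] V₀) :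
    k.coef i (act (refl P i) v) = -k.coef i v := by
  rw [Parameter.coef, LinearMap.smul_apply, LinearMap.smul_apply, corootC_refl, smul_neg]

theorem Parameter.coef_perm_self (i : ι) (v : ℂ ⊗[ℝ] V₀) :
    k.coef (P.reflectionPerm i i) v = -k.coef i v := by
  have h := k.coef_act (refl P i) (P.root_reflectionPerm i i) (act (refl P i) v)
  rwa [act_refl_refl, k.coef_refl] at h

open Classical in
/-- The sum `∑ k_β ⟨v, β^∨⟩ F(β)` over the positive roots `β` with `w⁻¹ β` negative. With
`F(β) = t_{s_β} t_w` it is the correction term in the commutation of `v` with `t_w`. -/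
noncomputable def Parameter.inversionSum [Finite ι] {E : Type*} [AddCommGroup E] [Module ℂ E]
    (w : reflectionGroup P) (v : ℂ ⊗[ℝ] V₀) (F : ι → E) : E :=
  letI := Fintype.ofFinite ι
  ∑ i, if IsInversion b w i then k.coef i v • F i else 0

/-- The inversions of `w` and of `s_α w` correspond to each other under `s_α`, except for `α`. -/
theorem Parameter.inversionSum_refl_mul [Finite ι] [P.IsReduced] {E : Type*} [AddCommGroup E]
    [Module ℂ E] (α : b.support) (w : reflectionGroup P) (v : ℂ ⊗[ℝ] V₀)
    (F : reflectionGroup P → E) :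
    k.inversionSum w v (fun i => F (refl P α * refl P i)) =
      k.inversionSum (refl P α * w) (act (refl P α) v) (fun i => F (refl P i * refl P α)) +
        (k.toFun α * corootC P α v) • F 1 := by
  classical
  let _ := Fintype.ofFinite ι
  have hne : (α : ι) ≠ P.reflectionPerm α α := by
    intro h
    have h1 : P.root (P.reflectionPerm α α) = -P.root α := by simp
    rw [← h] at h1
    exact neg_notMem b (simple_mem b α.2) (h1 ▸ simple_mem b α.2)
  have hα := simple_mem b α.2
  have hsα : P.reflection α (P.root α) = -P.root α := P.reflection_apply_self α
  unfold Parameter.inversionSum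
  rw [← sub_eq_iff_eq_add', ← Equiv.sum_comp (P.reflectionPerm α) (fun i => if IsInversion b
    (refl P α * w) i then k.coef i (act (refl P α) v) • F (refl P i * refl P α) else 0),
    ← Finset.sum_sub_distrib, ← k.coef_simple]
  have hinv : ∀ i, IsInversion b (refl P α * w) (P.reflectionPerm α i) ↔
      (P.reflection α (P.root i) ∈ b.posRoots ∧ -((w⁻¹).1 (P.root i)) ∈ b.posRoots) := by
    intro i
    unfold IsInversion
    rw [P.root_reflectionPerm]
    have : ((refl P α * w)⁻¹).1 (P.reflection α (P.root i)) = (w⁻¹).1 (P.root i) := by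
      rw [mul_inv_rev, refl_inv]
      change (w⁻¹).1 (P.reflection α (P.reflection α (P.root i))) = _
      rw [P.reflection_same]
    rw [this]
  have hF : ∀ i, refl P (P.reflectionPerm α i) * refl P α = refl P α * refl P i := by
    intro i
    rw [← mul_refl_mul_inv (refl P α) (P.root_reflectionPerm α i), inv_mul_cancel_right]
  simp only [hinv, hF, k.coef_act (refl P α) (P.root_reflectionPerm α _)]
  -- Only `α` and `-α` contribute: `s_α` permutes the other positive roots.
  rw [Finset.sum_eq_add (α : ι) (P.reflectionPerm α α) hne]
  · rw [k.coef_perm_self, refl_perm_self, refl_mul_self]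
    unfold IsInversion
    rw [P.root_reflectionPerm, P.reflection_same, hsα, map_neg, neg_neg]
    have h1 : (P.root α ∈ b.posRoots) = True := eq_true hα
    have h2 : (-P.root α ∈ b.posRoots) = False := eq_false (neg_notMem b hα)
    simp only [h1, h2, true_and, false_and, if_false]
    rcases mem_or_neg_mem b (apply_mem_range w⁻¹ hα.1) with h | h
    · rw [if_neg (neg_notMem b h), if_pos h]
      simp
    · rw [if_pos h, if_neg (fun h' => neg_notMem b h' h)]
      simp
  · rintro i - ⟨h1, h2⟩
    have key : P.root i ∈ b.posRoots ↔ P.reflection α (P.root i) ∈ b.posRoots := by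
      constructor
      · exact fun h => refl_mem b h α.2 fun h' => h1 (P.root.injective h')
      · intro h
        have := refl_mem b h α.2 (fun h' => h2 (P.root.injective (by
          rw [P.root_reflectionPerm, hsα, ← P.reflection_same α (P.root i), h', hsα])))
        rwa [P.reflection_same] at this
    unfold IsInversion
    simp only [key, sub_self]
  · intro h; exact absurd (Finset.mem_univ _) h
  · intro h; exact absurd (Finset.mem_univ _) h

section inversionSum

variable [Finite ι] {E E' : Type*} [AddCommGroup E] [Module ℂ E] [AddCommGroup E'] [Module ℂ E']

theorem Parameter.map_inversionSum (g : E →ₗ[ℂ] E') (w : reflectionGroup P) (v : ℂ ⊗[ℝ] V₀)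
    (F : ι → E) : g (k.inversionSum w v F) = k.inversionSum w v (fun i => g (F i)) := by
  unfold Parameter.inversionSum
  simp only [map_sum, apply_ite g, map_smul, map_zero]

theorem Parameter.inversionSum_add (w : reflectionGroup P) (v : ℂ ⊗[ℝ] V₀) (F F' : ι → E) :
    k.inversionSum w v (fun i => F i + F' i) = k.inversionSum w v F + k.inversionSum w v F' := by
  unfold Parameter.inversionSum
  rw [← Finset.sum_add_distrib]
  refine Finset.sum_congr rfl fun i _ => ?_
  split_ifs
  · rw [smul_add]
  · rw [add_zero]

theorem Parameter.inversionSum_add_left (w : reflectionGroup P) (v v' : ℂ ⊗[ℝ] V₀) (F : ι → E) :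
    k.inversionSum w (v + v') F = k.inversionSum w v F + k.inversionSum w v' F := by
  unfold Parameter.inversionSum
  rw [← Finset.sum_add_distrib]
  refine Finset.sum_congr rfl fun i _ => ?_
  split_ifs
  · rw [map_add, add_smul]
  · rw [add_zero]

theorem Parameter.inversionSum_smul_left (w : reflectionGroup P) (z : ℂ) (v : ℂ ⊗[ℝ] V₀)
    (F : ι → E) : k.inversionSum w (z • v) F = z • k.inversionSum w v F := by
  unfold Parameter.inversionSum
  rw [Finset.smul_sum]
  refine Finset.sum_congr rfl fun i _ => ?_
  split_ifs
  · rw [map_smul, smul_assoc]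
  · rw [smul_zero]

theorem Parameter.inversionSum_zero (w : reflectionGroup P) (v : ℂ ⊗[ℝ] V₀) :
    k.inversionSum w v (fun _ => (0 : E)) = 0 := by
  unfold Parameter.inversionSum
  simp only [smul_zero, ite_self, Finset.sum_const_zero]

theorem Parameter.inversionSum_one (v : ℂ ⊗[ℝ] V₀) (F : ι → E) : k.inversionSum 1 v F = 0 := by
  unfold Parameter.inversionSum
  refine Finset.sum_eq_zero fun i _ => if_neg fun h => ?_
  have h2 := h.2
  rw [inv_one] at h2
  exact neg_notMem b h.1 h2

theorem Parameter.inversionSum_congr (w : reflectionGroup P) (v : ℂ ⊗[ℝ] V₀) {F F' : ι → E}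
    (h : ∀ i, IsInversion b w i → F i = F' i) :
    k.inversionSum w v F = k.inversionSum w v F' := by
  unfold Parameter.inversionSum
  refine Finset.sum_congr rfl fun i _ => ?_
  split_ifs with hi
  · rw [h i hi]
  · rfl

/-- Two elements have the same sum over inversions if `F` vanishes wherever their inversions
differ. -/
theorem Parameter.inversionSum_congr_left {w w' : reflectionGroup P} (v : ℂ ⊗[ℝ] V₀) {F : ι → E}
    (h : ∀ i, IsInversion b w i → ¬ IsInversion b w' i → F i = 0)
    (h' : ∀ i, IsInversion b w' i → ¬ IsInversion b w i → F i = 0) :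
    k.inversionSum w v F = k.inversionSum w' v F := by
  unfold Parameter.inversionSum
  refine Finset.sum_congr rfl fun i _ => ?_
  split_ifs with h1 h2 h2
  · rfl
  · rw [h i h1 h2, smul_zero]
  · rw [h' i h2 h1, smul_zero]
  · rfl

end inversionSum

end Coefficients

/-! ### A model of the induced modules -/

section Model

variable {ι N : Type*} {V₀ : Type u} [AddCommGroup V₀] [Module ℝ V₀] [AddCommGroup N] [Module ℝ N]
variable {P : RootPairing ι ℝ V₀ N} {b : SimpleRoots P} {k : Parameter b}

open HeckeAlgebra

theorem act_refl (i : ι) (v : ℂ ⊗[ℝ] V₀) :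
    act (refl P i) v = v - corootC P i v • ((1 : ℂ) ⊗ₜ[ℝ] P.root i) := by
  induction v with
  | zero => simp
  | tmul z v =>
    have h : (refl P i).1 v = v - P.coroot' i v • P.root i := P.reflection_apply i v
    rw [act_tmul, corootC_tmul, h, TensorProduct.tmul_sub, TensorProduct.smul_tmul', smul_eq_mul,
      mul_one, ← TensorProduct.smul_tmul, Complex.real_smul]
  | add x y hx hy =>
    rw [map_add, hx, hy, map_add, add_smul]
    abel

/-- The cross relations let a commutator of two elements of `V` move past `t_{s_α}`. This is why the
commutativity of the action of `V` need only be checked on a generating subspace. -/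
theorem commutator_mul_refl {M : Type*} [AddCommGroup M] [Module ℂ M] (i : ι) (κ : ℂ)
    (τ : M →ₗ[ℂ] M) (φ : (ℂ ⊗[ℝ] V₀) →ₗ[ℂ] Module.End ℂ M)
    (hc : ∀ v m, τ (φ v m) - φ (act (refl P i) v) (τ m) = (κ * corootC P i v) • m)
    (v v' : ℂ ⊗[ℝ] V₀) (m : M) :
    φ v (φ v' (τ m)) - φ v' (φ v (τ m)) =
      τ (φ (act (refl P i) v) (φ (act (refl P i) v') m) -
        φ (act (refl P i) v') (φ (act (refl P i) v) m)) := by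
  have h : ∀ v m, φ v (τ m) = τ (φ (act (refl P i) v) m) + (κ * corootC P i v) • m := by
    intro v m
    have := hc (act (refl P i) v) m
    rw [act_refl_refl, corootC_refl, mul_neg, neg_smul, ← neg_sub, neg_inj] at this
    exact sub_eq_iff_eq_add'.mp this
  have h2 : ∀ v v', φ v (φ v' (τ m)) = τ (φ (act (refl P i) v) (φ (act (refl P i) v') m)) +
      (κ * corootC P i v) • φ v' m + (κ * corootC P i v') • φ v m -
        (κ * corootC P i v * corootC P i v') • φ ((1 : ℂ) ⊗ₜ[ℝ] P.root i) m := by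
    intro v v'
    have h3 : φ (act (refl P i) v') m =
        φ v' m - corootC P i v' • φ ((1 : ℂ) ⊗ₜ[ℝ] P.root i) m := by
      rw [act_refl, map_sub, map_smul, LinearMap.sub_apply, LinearMap.smul_apply]
    rw [h v', map_add, h v, map_smul, h3, smul_sub, smul_smul]
    abel
  rw [h2, h2, map_sub, mul_right_comm κ (corootC P i v')]
  abel

/-- The model of `ℍ ⊗_{ℍ_J} X` for an `ℍ`-module `X`: the finitely supported functions from
`W / W_J` to `X`. The function supported at `w W_J` with value `x` stands for `t_w ⊗ t_w⁻¹ x`. This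
is a type of its own because `ℍ` does not act pointwise. -/
def Model {J : Finset ι} (_ : J ⊆ b.support) (X : Type u) [AddCommGroup X] : Type u :=
  (reflectionGroup P ⧸ parabolic P J) →₀ X

variable {J : Finset ι} (hJ : J ⊆ b.support)
variable {X : Type u} [AddCommGroup X] [Module ℂ X]

noncomputable instance : AddCommGroup (Model hJ X) :=
  inferInstanceAs (AddCommGroup ((reflectionGroup P ⧸ parabolic P J) →₀ X))

noncomputable instance : Module ℂ (Model hJ X) :=
  inferInstanceAs (Module ℂ ((reflectionGroup P ⧸ parabolic P J) →₀ X))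

instance [Finite ι] [FiniteDimensional ℂ X] : FiniteDimensional ℂ (Model hJ X) :=
  have := finite_reflectionGroup P
  inferInstanceAs (Module.Finite ℂ ((reflectionGroup P ⧸ parabolic P J) →₀ X))

namespace Model

/-- The function with value `x` at `c` and `0` elsewhere. -/
noncomputable def single (c : reflectionGroup P ⧸ parabolic P J) : X →ₗ[ℂ] Model hJ X :=
  Finsupp.lsingle c

/-- The linear map on the model with prescribed values on the functions supported at one point. -/
noncomputable def lsum {E : Type*} [AddCommGroup E] [Module ℂ E]
    (g : reflectionGroup P ⧸ parabolic P J → X →ₗ[ℂ] E) : Model hJ X →ₗ[ℂ] E :=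
  Finsupp.lsum ℂ g

@[simp] theorem lsum_single {E : Type*} [AddCommGroup E] [Module ℂ E]
    (g : reflectionGroup P ⧸ parabolic P J → X →ₗ[ℂ] E) (c) (x : X) :
    lsum hJ g (single hJ c x) = g c x :=
  Finsupp.lsum_single ℂ g c x

variable {hJ} in
theorem hom_ext {E : Type*} [AddCommGroup E] [Module ℂ E] {g g' : Model hJ X →ₗ[ℂ] E}
    (h : ∀ (w : reflectionGroup P) x, g (single hJ w x) = g' (single hJ w x)) : g = g' := by
  refine Finsupp.lhom_ext fun c x => ?_
  obtain ⟨w, rfl⟩ := QuotientGroup.mk_surjective c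
  exact h w x

variable [Module (HeckeAlgebra b k) X] [IsScalarTower ℂ (HeckeAlgebra b k) X]

/-- The action of `t_w`. -/
noncomputable def tEnd (k : Parameter b) [Module (HeckeAlgebra b k) X]
    [IsScalarTower ℂ (HeckeAlgebra b k) X] : reflectionGroup P →* Module.End ℂ (Model hJ X) where
  toFun w := lsum hJ fun c => single hJ (w • c) ∘ₗ Algebra.lsmul ℂ ℂ X (t b k w)
  map_one' := hom_ext fun w x => by simp
  map_mul' w w' := hom_ext fun w x => by simp [mul_smul]

@[simp] theorem tEnd_single (u w : reflectionGroup P) (x : X) :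
    tEnd hJ k u (single hJ w x) =
      single hJ ((u * w : reflectionGroup P) : reflectionGroup P ⧸ parabolic P J)
        (t b k u • x) := by
  simp [tEnd]

variable [Finite ι]

/-- The image under `v` of the function supported at `w W_J` with value `x`. The formula is the one
which the commutation of `v` with `t_w` forces on `v t_w ⊗ t_w⁻¹ x`. -/
noncomputable def fCol (k : Parameter b) [Module (HeckeAlgebra b k) X]
    [IsScalarTower ℂ (HeckeAlgebra b k) X] (w : reflectionGroup P) :
    (ℂ ⊗[ℝ] V₀) →ₗ[ℂ] X →ₗ[ℂ] Model hJ X :=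
  LinearMap.mk₂ ℂ (fun v x => single hJ w (f b k v • x) + k.inversionSum w v fun i =>
      single hJ ((refl P i * w : reflectionGroup P) : reflectionGroup P ⧸ parabolic P J)
        (t b k (refl P i) • x) - single hJ w (t b k (refl P i) • x))
    (fun v v' x => by
      simp only [map_add, add_smul, k.inversionSum_add_left]
      abel)
    (fun z v x => by
      simp only [map_smul, smul_assoc, k.inversionSum_smul_left, smul_add])
    (fun v x x' => by
      simp only [map_add, smul_add, add_sub_add_comm, k.inversionSum_add]
      abel)
    (fun z v x => by
      have h : ∀ h : HeckeAlgebra b k, h • z • x = z • h • x := fun h =>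
        (Algebra.lsmul ℂ ℂ X h).map_smul z x
      have h2 := k.map_inversionSum (z • LinearMap.id : Model hJ X →ₗ[ℂ] Model hJ X) w v
      simp only [LinearMap.smul_apply, LinearMap.id_apply] at h2
      simp only [h, map_smul, smul_add, h2, smul_sub])

theorem fCol_apply (w : reflectionGroup P) (v : ℂ ⊗[ℝ] V₀) (x : X) :
    fCol hJ k w v x = single hJ w (f b k v • x) + k.inversionSum w v fun i =>
      single hJ ((refl P i * w : reflectionGroup P) : reflectionGroup P ⧸ parabolic P J)
        (t b k (refl P i) • x) - single hJ w (t b k (refl P i) • x) := rfl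

variable [P.IsReduced]

/-- The action of `v` is well-defined on cosets. -/
theorem fCol_eq {w w' : reflectionGroup P}
    (h : (w : reflectionGroup P ⧸ parabolic P J) = w') : fCol hJ k (X := X) w = fCol hJ k w' := by
  refine LinearMap.ext fun v => LinearMap.ext fun x => ?_
  have h3 : ∀ i, ((refl P i * w : reflectionGroup P) : reflectionGroup P ⧸ parabolic P J) =
      ((refl P i * w' : reflectionGroup P) : reflectionGroup P ⧸ parabolic P J) := fun i =>
    congrArg (fun c => refl P i • c) h
  rw [fCol_apply, fCol_apply, ← h]
  simp only [← h3]
  congr 1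
  refine k.inversionSum_congr_left v (fun i h1 h2 => ?_) (fun i h1 h2 => ?_)
  · rw [refl_mul_coset hJ h h1 h2, sub_self]
  · rw [h3, refl_mul_coset hJ h.symm h1 h2, h, sub_self]

/-- The action of `v`. By `fCol_eq`, the choice of coset representatives is immaterial. -/
noncomputable def fEnd (k : Parameter b) [Module (HeckeAlgebra b k) X]
    [IsScalarTower ℂ (HeckeAlgebra b k) X] : (ℂ ⊗[ℝ] V₀) →ₗ[ℂ] Module.End ℂ (Model hJ X) where
  toFun v := lsum hJ fun c => fCol hJ k c.out v
  map_add' v v' := hom_ext fun w x => by simp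
  map_smul' z v := hom_ext fun w x => by simp

theorem fEnd_single (v : ℂ ⊗[ℝ] V₀) (w : reflectionGroup P) (x : X) :
    fEnd hJ k v (single hJ w x) = fCol hJ k w v x := by
  change lsum hJ _ _ = _
  rw [lsum_single, fCol_eq hJ (QuotientGroup.out_eq' (w : reflectionGroup P ⧸ parabolic P J))]

/-- The cross relations hold on the model, since the inversions of `w` and `s_α w` differ by `α`. -/
theorem end_cross (α : b.support) (v : ℂ ⊗[ℝ] V₀) :
    tEnd hJ k (refl P α) * fEnd hJ k (X := X) v -
      fEnd hJ k (act (refl P α) v) * tEnd hJ k (refl P α) =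
      algebraMap ℂ (Module.End ℂ (Model hJ X)) (k.toFun α * corootC P α v) := by
  refine hom_ext fun w x => ?_
  have h1 : t b k (refl P α) • f b k v • x = f b k (act (refl P α) v) • t b k (refl P α) • x +
      (k.toFun α * corootC P α v) • x := by
    have := congrArg (· • x) (cross (k := k) α v)
    simp only [sub_smul, mul_smul, algebraMap_smul] at this
    rw [mul_smul (k.toFun α)]
    exact sub_eq_iff_eq_add'.mp this
  have h2 := k.inversionSum_refl_mul α w v fun g =>
    single hJ ((g * w : reflectionGroup P) : reflectionGroup P ⧸ parabolic P J) (t b k g • x) -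
    single hJ ((refl P α * w : reflectionGroup P) : reflectionGroup P ⧸ parabolic P J)
      (t b k g • x)
  rw [LinearMap.sub_apply, Module.End.mul_apply, Module.End.mul_apply, tEnd_single, fEnd_single,
    fEnd_single, fCol_apply, fCol_apply, map_add, k.map_inversionSum, tEnd_single,
    Module.algebraMap_end_apply, h1]
  simp only [map_sub, tEnd_single, ← mul_smul, ← map_mul (t b k), ← mul_assoc] at h2 ⊢
  rw [h2]
  simp only [map_add, map_smul, one_mul, map_one, one_smul, smul_sub, mul_assoc]
  abel

theorem fEnd_tEnd (α : b.support) (v : ℂ ⊗[ℝ] V₀) (m : Model hJ X) :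
    tEnd hJ k (refl P α) (fEnd hJ k v m) - fEnd hJ k (act (refl P α) v) (tEnd hJ k (refl P α) m) =
      (k.toFun α * corootC P α v) • m := by
  rw [← Module.algebraMap_end_apply (S := ℂ), ← end_cross (k := k) hJ α v, LinearMap.sub_apply,
    Module.End.mul_apply, Module.End.mul_apply]

/-- Commutativity need only be checked on `1 ⊗ x`, where it holds because it holds on `X`. -/
theorem end_comm (v v' : ℂ ⊗[ℝ] V₀) :
    fEnd hJ k (X := X) v * fEnd hJ k v' = fEnd hJ k v' * fEnd hJ k v := by
  have key : ∀ (L : List b.support) (v v' : ℂ ⊗[ℝ] V₀) (m : Model hJ X),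
      (∀ v v', fEnd hJ k v (fEnd hJ k v' m) = fEnd hJ k v' (fEnd hJ k v m)) →
      fEnd hJ k v (fEnd hJ k v' (tEnd hJ k (L.map fun a : b.support => refl P a).prod m)) =
      fEnd hJ k v' (fEnd hJ k v (tEnd hJ k (L.map fun a : b.support => refl P a).prod m)) := by
    intro L
    induction L with
    | nil =>
      intro v v' m hm
      rw [List.map_nil, List.prod_nil, map_one]
      exact hm v v'
    | cons α L ih =>
      intro v v' m hm
      rw [List.map_cons, List.prod_cons, map_mul]
      have hc := fEnd_tEnd (k := k) (X := X) hJ α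
      have h := commutator_mul_refl (α : ι) (k.toFun α) (tEnd hJ k (refl P α)) (fEnd hJ k) hc v v'
        (tEnd hJ k (L.map fun a : b.support => refl P a).prod m)
      rw [ih _ _ m hm, sub_self, map_zero, sub_eq_zero] at h
      exact h
  refine hom_ext fun w x => ?_
  obtain ⟨L, rfl⟩ := exists_list b w
  have h1 := key L v v' (single hJ ((1 : reflectionGroup P) : reflectionGroup P ⧸ parabolic P J)
    (t b k (L.map fun a : b.support => refl P a).prod⁻¹ • x)) (by
      intro v v'
      simp only [fEnd_single, fCol_apply, k.inversionSum_one, add_zero]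
      rw [smul_smul (f b k v), smul_smul (f b k v'), f_comm])
  rwa [tEnd_single, ← mul_smul, ← map_mul, mul_inv_cancel, map_one, one_smul, mul_one] at h1

/-- The action of `ℍ` on the model. -/
noncomputable def toEnd (k : Parameter b) [Module (HeckeAlgebra b k) X]
    [IsScalarTower ℂ (HeckeAlgebra b k) X] :
    HeckeAlgebra b k →ₐ[ℂ] Module.End ℂ (Model hJ X) :=
  lift (tEnd hJ k) (fEnd hJ k) (end_comm (X := X) hJ) (end_cross (X := X) hJ)

noncomputable instance : Module (HeckeAlgebra b k) (Model hJ X) :=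
  Module.compHom _ (toEnd hJ k (X := X)).toRingHom

instance : IsScalarTower ℂ (HeckeAlgebra b k) (Model hJ X) :=
  ⟨fun z h m => by
    change toEnd hJ k (z • h) m = z • toEnd hJ k h m
    rw [map_smul]; rfl⟩

theorem t_smul_single (u w : reflectionGroup P) (x : X) :
    t b k u • single hJ (w : reflectionGroup P ⧸ parabolic P J) x =
      single hJ ((u * w : reflectionGroup P) : reflectionGroup P ⧸ parabolic P J)
        (t b k u • x) := by
  change toEnd hJ k (t b k u) _ = _
  rw [toEnd, lift_t, tEnd_single]

theorem f_smul_single (v : ℂ ⊗[ℝ] V₀) (w : reflectionGroup P) (x : X) :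
    f b k v • single hJ (w : reflectionGroup P ⧸ parabolic P J) x =
      single hJ w (f b k v • x) + k.inversionSum w v fun i =>
      single hJ ((refl P i * w : reflectionGroup P) : reflectionGroup P ⧸ parabolic P J)
        (t b k (refl P i) • x) - single hJ w (t b k (refl P i) • x) := by
  change toEnd hJ k (f b k v) _ = _
  rw [toEnd, lift_f, fEnd_single, fCol_apply]

end Model

end Model

/-! ### Comparison with the induced modules -/

section Comparison

variable {ι N : Type*} {V₀ : Type u} [AddCommGroup V₀] [Module ℝ V₀] [AddCommGroup N] [Module ℝ N]
variable {P : RootPairing ι ℝ V₀ N} {b : SimpleRoots P} {k : Parameter b}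

open HeckeAlgebra

namespace Model

/-- A linear map between `ℍ`-modules which intertwines the generators, up to a twist `δ`,
intertwines the actions of `ℍ`. -/
theorem map_smul_of_generators {X Y : Type*} [AddCommGroup X] [Module ℂ X]
    [Module (HeckeAlgebra b k) X] [IsScalarTower ℂ (HeckeAlgebra b k) X]
    [AddCommGroup Y] [Module ℂ Y] [Module (HeckeAlgebra b k) Y]
    [IsScalarTower ℂ (HeckeAlgebra b k) Y] (δ : HeckeAlgebra b k →ₐ[ℂ] HeckeAlgebra b k)
    (g : X →ₗ[ℂ] Y)
    (ht : ∀ w x, g (δ (t b k w) • x) = t b k w • g x)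
    (hf : ∀ v x, g (δ (f b k v) • x) = f b k v • g x) (h : HeckeAlgebra b k) (x : X) :
    g (δ h • x) = h • g x := by
  induction h using HeckeAlgebra.induction generalizing x with
  | halg z => rw [AlgHom.commutes, algebraMap_smul, algebraMap_smul, map_smul]
  | ht w => exact ht w x
  | hf v => exact hf v x
  | hmul a c ha hc => rw [map_mul, mul_smul, ha, hc, mul_smul]
  | hadd a c ha hc => rw [map_add, add_smul, map_add, ha, hc, add_smul]

variable {J : Finset ι}

theorem mkQ_mul_tmul {X : Type u} [AddCommGroup X] [Module ℂ X]
    [Module (HeckeAlgebra b k) X] {a c : HeckeAlgebra b k}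
    (hc : c ∈ parabolicSubalgebra b k J) (x : X) :
    (balanced (parabolicSubalgebra b k J) X).mkQ ((a * c) ⊗ₜ x) =
      (balanced (parabolicSubalgebra b k J) X).mkQ (a ⊗ₜ (c • x)) :=
  (Submodule.Quotient.eq _).mpr (Submodule.subset_span ⟨a, ⟨c, hc⟩, x, rfl⟩)

end Model

variable {J : Finset ι} (hJ : J ⊆ b.support)
variable {X : Type u} [AddCommGroup X] [Module ℂ X]
variable [Module (HeckeAlgebra b k) X] [IsScalarTower ℂ (HeckeAlgebra b k) X]
variable [Finite ι] [P.IsReduced]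

namespace Model

/-- The map `x ↦ 1 ⊗ x` is linear over `ℍ_J`. -/
theorem single_one_smul (c : HeckeAlgebra b k) (hc : c ∈ parabolicSubalgebra b k J) (x : X) :
    single hJ ((1 : reflectionGroup P) : reflectionGroup P ⧸ parabolic P J) (c • x) =
      c • single hJ ((1 : reflectionGroup P) : reflectionGroup P ⧸ parabolic P J) x := by
  induction hc using Algebra.adjoin_induction generalizing x with
  | mem a ha =>
    rcases ha with ⟨v, rfl⟩ | ⟨u, hu, rfl⟩
    · rw [f_smul_single, k.inversionSum_one, add_zero]
    · rw [t_smul_single, mul_one]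
      congr 2
      rw [QuotientGroup.eq, inv_one, one_mul]
      exact hu
  | algebraMap z => rw [algebraMap_smul, algebraMap_smul, map_smul]
  | add a c _ _ ha hc => rw [add_smul, map_add, ha, hc, add_smul]
  | mul a c _ _ ha hc => rw [mul_smul, ha, hc, mul_smul]

theorem t_smul_single_one (w : reflectionGroup P) (x : X) :
    t b k w • single hJ ((1 : reflectionGroup P) : reflectionGroup P ⧸ parabolic P J)
      (t b k w⁻¹ • x) = single hJ w x := by
  rw [t_smul_single, mul_one, ← mul_smul, ← map_mul, mul_inv_cancel, map_one, one_smul]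

/-- The map `h ⊗ x ↦ h • x` on `ℍ ⊗_ℂ X`. -/
noncomputable def actTensor (k : Parameter b) [Module (HeckeAlgebra b k) X]
    [IsScalarTower ℂ (HeckeAlgebra b k) X] :
    HeckeAlgebra b k ⊗[ℂ] X →ₗ[HeckeAlgebra b k] Model hJ X :=
  TensorProduct.AlgebraTensorModule.lift
    { toFun := fun h =>
        { toFun := fun x => h • single hJ ((1 : reflectionGroup P) : _ ⧸ parabolic P J) x
          map_add' := fun x y => by rw [map_add, smul_add]
          map_smul' := fun z x => by
            rw [map_smul, RingHom.id_apply]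
            exact (Algebra.lsmul ℂ ℂ (Model hJ X) h).map_smul z _ }
      map_add' := fun h h' => LinearMap.ext fun x => add_smul _ _ _
      map_smul' := fun h h' => LinearMap.ext fun x => mul_smul h h' _ }

@[simp] theorem actTensor_tmul (h : HeckeAlgebra b k) (x : X) :
    actTensor hJ k (h ⊗ₜ x) =
      h • single hJ ((1 : reflectionGroup P) : reflectionGroup P ⧸ parabolic P J) x := rfl

/-- The canonical map from the induced module to its model. -/
noncomputable def ofInd (k : Parameter b) [Module (HeckeAlgebra b k) X]
    [IsScalarTower ℂ (HeckeAlgebra b k) X] :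
    Ind (parabolicSubalgebra b k J) X →ₗ[HeckeAlgebra b k] Model hJ X :=
  (balanced (parabolicSubalgebra b k J) X).liftQ (actTensor hJ k) <| by
    refine Submodule.span_le.mpr ?_
    rintro _ ⟨a, c, y, rfl⟩
    rw [SetLike.mem_coe, LinearMap.mem_ker, map_sub, actTensor_tmul, actTensor_tmul]
    change _ - a • single hJ _ ((c : HeckeAlgebra b k) • y) = 0
    rw [single_one_smul hJ (c : HeckeAlgebra b k) c.2, mul_smul, sub_self]

theorem ofInd_mk (h : HeckeAlgebra b k) (x : X) :
    ofInd hJ k ((balanced (parabolicSubalgebra b k J) X).mkQ (h ⊗ₜ x)) =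
      h • single hJ ((1 : reflectionGroup P) : reflectionGroup P ⧸ parabolic P J) x := rfl

/-- The induced module is spanned by the elements `t_w ⊗ x`. -/
theorem ind_hom_ext {X : Type u} [AddCommGroup X] [Module ℂ X] [Module (HeckeAlgebra b k) X]
    {E : Type*} [AddCommGroup E] [Module ℂ E]
    {g g' : Ind (parabolicSubalgebra b k J) X →ₗ[ℂ] E}
    (h : ∀ w x, g ((balanced (parabolicSubalgebra b k J) X).mkQ (t b k w ⊗ₜ x)) =
      g' ((balanced (parabolicSubalgebra b k J) X).mkQ (t b k w ⊗ₜ x))) : g = g' := by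
  refine LinearMap.ext fun z => ?_
  obtain ⟨z, rfl⟩ := (balanced (parabolicSubalgebra b k J) X).mkQ_surjective z
  induction z with
  | zero => simp
  | tmul a x =>
    have ha : a ∈ Submodule.span ℂ {y : HeckeAlgebra b k | ∃ w,
        ∃ c ∈ parabolicSubalgebra b k J, y = t b k w * c} := by
      rw [span_t_mul]; trivial
    induction ha using Submodule.span_induction with
    | mem y hy =>
      obtain ⟨w, c, hc, rfl⟩ := hy
      rw [mkQ_mul_tmul hc, h]
    | zero => rw [TensorProduct.zero_tmul, map_zero, map_zero, map_zero]
    | add y y' _ _ h1 h2 => rw [TensorProduct.add_tmul, map_add, map_add, map_add, h1, h2]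
    | smul z y _ h1 =>
      have : (balanced (parabolicSubalgebra b k J) X).mkQ ((z • y) ⊗ₜ x) =
          z • (balanced (parabolicSubalgebra b k J) X).mkQ (y ⊗ₜ x) := rfl
      rw [this, map_smul, map_smul, h1]
  | add y y' h1 h2 => rw [map_add, map_add, map_add, h1, h2]

/-- The elements `t_w ⊗ x` span the induced module, so `t_w ⊗ x ↦ (t_w x at w W_J)` has the left
inverse `(x at c) ↦ t_w ⊗ t_w⁻¹ x`, where `w` is a representative of `c`. -/
theorem ofInd_bijective (k : Parameter b) [Module (HeckeAlgebra b k) X]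
    [IsScalarTower ℂ (HeckeAlgebra b k) X] :
    Function.Bijective (ofInd hJ k (X := X)) := by
  constructor
  · let q : (HeckeAlgebra b k ⊗[ℂ] X) →ₗ[ℂ] Ind (parabolicSubalgebra b k J) X :=
      (balanced (parabolicSubalgebra b k J) X).mkQ.restrictScalars ℂ
    let g : Model hJ X →ₗ[ℂ] Ind (parabolicSubalgebra b k J) X :=
      lsum hJ fun c => q ∘ₗ TensorProduct.mk ℂ _ X (t b k c.out) ∘ₗ
        Algebra.lsmul ℂ ℂ X (t b k c.out⁻¹)
    have hg : g ∘ₗ (ofInd hJ k (X := X)).restrictScalars ℂ = LinearMap.id := by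
      refine ind_hom_ext fun w x => ?_
      rw [LinearMap.comp_apply, LinearMap.restrictScalars_apply, ofInd_mk, t_smul_single, mul_one]
      change lsum hJ _ _ = _
      rw [lsum_single]
      change (balanced (parabolicSubalgebra b k J) X).mkQ (t b k _ ⊗ₜ (t b k _ • t b k w • x)) = _
      set w' := (w : reflectionGroup P ⧸ parabolic P J).out with hw'
      have hmem : t b k (w'⁻¹ * w) ∈ parabolicSubalgebra b k J :=
        Algebra.subset_adjoin (Or.inr ⟨_, QuotientGroup.eq.mp
          (QuotientGroup.out_eq' (w : reflectionGroup P ⧸ parabolic P J)), rfl⟩)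
      rw [← mul_smul, ← map_mul, ← mkQ_mul_tmul hmem, ← map_mul, mul_inv_cancel_left]
      rfl
    exact Function.LeftInverse.injective (g := g) fun z => LinearMap.congr_fun hg z
  · rw [← LinearMap.range_eq_top, ← top_le_iff]
    have h : (⊤ : Submodule ℂ (Model hJ X)) ≤
        (LinearMap.range (ofInd hJ k (X := X))).restrictScalars ℂ := by
      have h2 : ((LinearMap.range (ofInd hJ k (X := X))).restrictScalars ℂ).mkQ = 0 := by
        refine hom_ext fun w x => ?_
        rw [LinearMap.zero_apply, Submodule.mkQ_apply, Submodule.Quotient.mk_eq_zero]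
        refine ⟨(balanced (parabolicSubalgebra b k J) X).mkQ (t b k w ⊗ₜ (t b k w⁻¹ • x)), ?_⟩
        rw [ofInd_mk, t_smul_single_one]
      rw [← Submodule.ker_mkQ ((LinearMap.range (ofInd hJ k (X := X))).restrictScalars ℂ), h2,
        LinearMap.ker_zero]
    exact h

/-- The functoriality of the model in the module. -/
noncomputable def map {X Y : Type u} [AddCommGroup X] [Module ℂ X]
    [Module (HeckeAlgebra b k) X] [IsScalarTower ℂ (HeckeAlgebra b k) X]
    [AddCommGroup Y] [Module ℂ Y] [Module (HeckeAlgebra b k) Y]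
    [IsScalarTower ℂ (HeckeAlgebra b k) Y] (g : X →ₗ[HeckeAlgebra b k] Y) :
    Model hJ X →ₗ[HeckeAlgebra b k] Model hJ Y :=
  let g₁ : Model hJ X →ₗ[ℂ] Model hJ Y := Finsupp.mapRange.linearMap (g.restrictScalars ℂ)
  have hg : ∀ (w : reflectionGroup P) x, g₁ (single hJ w x) = single hJ w (g x) := fun w x =>
    Finsupp.mapRange_single (hf := map_zero g)
  { toFun := g₁
    map_add' := map_add g₁
    map_smul' := map_smul_of_generators (AlgHom.id ℂ _) g₁
      (fun u m => by
        have : g₁ ∘ₗ Algebra.lsmul ℂ ℂ _ (t b k u) = Algebra.lsmul ℂ ℂ _ (t b k u) ∘ₗ g₁ :=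
          hom_ext fun w x => by
            simp only [LinearMap.comp_apply, Algebra.lsmul_coe, t_smul_single, hg, map_smul]
        exact LinearMap.congr_fun this m)
      (fun v m => by
        have : g₁ ∘ₗ Algebra.lsmul ℂ ℂ _ (f b k v) = Algebra.lsmul ℂ ℂ _ (f b k v) ∘ₗ g₁ :=
          hom_ext fun w x => by
            simp only [LinearMap.comp_apply, Algebra.lsmul_coe, f_smul_single, hg, map_smul,
              map_add, k.map_inversionSum, map_sub]
        exact LinearMap.congr_fun this m) }

/-- The projection from the model for `J` to the model for a larger subset `K`. -/
noncomputable def proj {J K : Finset ι} (hJ : J ⊆ b.support) (hK : K ⊆ b.support) (hJK : J ⊆ K)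
    (k : Parameter b) [Module (HeckeAlgebra b k) X] [IsScalarTower ℂ (HeckeAlgebra b k) X] :
    Model hJ X →ₗ[HeckeAlgebra b k] Model hK X :=
  let g₁ : Model hJ X →ₗ[ℂ] Model hK X := lsum hJ fun c => single hK (c.out : reflectionGroup P)
  have hg : ∀ (w : reflectionGroup P) x, g₁ (single hJ w x) = single hK w x := fun w x => by
    simp only [g₁, lsum_single]
    congr 2
    exact QuotientGroup.eq.mpr (Subgroup.closure_mono (Set.image_mono (by exact_mod_cast hJK))
      (QuotientGroup.eq.mp (QuotientGroup.out_eq' (w : reflectionGroup P ⧸ parabolic P J))))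
  { toFun := g₁
    map_add' := map_add g₁
    map_smul' := map_smul_of_generators (AlgHom.id ℂ _) g₁
      (fun u m => by
        have : g₁ ∘ₗ Algebra.lsmul ℂ ℂ _ (t b k u) = Algebra.lsmul ℂ ℂ _ (t b k u) ∘ₗ g₁ :=
          hom_ext fun w x => by
            simp only [LinearMap.comp_apply, Algebra.lsmul_coe, t_smul_single, hg]
        exact LinearMap.congr_fun this m)
      (fun v m => by
        have : g₁ ∘ₗ Algebra.lsmul ℂ ℂ _ (f b k v) = Algebra.lsmul ℂ ℂ _ (f b k v) ∘ₗ g₁ :=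
          hom_ext fun w x => by
            simp only [LinearMap.comp_apply, Algebra.lsmul_coe, f_smul_single, hg, map_add,
              k.map_inversionSum, map_sub]
        exact LinearMap.congr_fun this m) }

theorem map_apply {X Y : Type u} [AddCommGroup X] [Module ℂ X]
    [Module (HeckeAlgebra b k) X] [IsScalarTower ℂ (HeckeAlgebra b k) X]
    [AddCommGroup Y] [Module ℂ Y] [Module (HeckeAlgebra b k) Y]
    [IsScalarTower ℂ (HeckeAlgebra b k) Y] (g : X →ₗ[HeckeAlgebra b k] Y) (m : Model hJ X)
    (c : reflectionGroup P ⧸ parabolic P J) :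
    DFunLike.coe (F := (reflectionGroup P ⧸ parabolic P J) →₀ Y) (map hJ g m) c =
      g (DFunLike.coe (F := (reflectionGroup P ⧸ parabolic P J) →₀ X) m c) := rfl

theorem map_injective {X Y : Type u} [AddCommGroup X] [Module ℂ X]
    [Module (HeckeAlgebra b k) X] [IsScalarTower ℂ (HeckeAlgebra b k) X]
    [AddCommGroup Y] [Module ℂ Y] [Module (HeckeAlgebra b k) Y]
    [IsScalarTower ℂ (HeckeAlgebra b k) Y] {g : X →ₗ[HeckeAlgebra b k] Y}
    (hg : Function.Injective g) : Function.Injective (map hJ g) := fun m m' h =>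
  Finsupp.ext fun c => hg (by rw [← map_apply hJ g, h, map_apply])

theorem map_surjective {X Y : Type u} [AddCommGroup X] [Module ℂ X]
    [Module (HeckeAlgebra b k) X] [IsScalarTower ℂ (HeckeAlgebra b k) X]
    [AddCommGroup Y] [Module ℂ Y] [Module (HeckeAlgebra b k) Y]
    [IsScalarTower ℂ (HeckeAlgebra b k) Y] {g : X →ₗ[HeckeAlgebra b k] Y}
    (hg : Function.Surjective g) : Function.Surjective (map hJ g) :=
  Finsupp.mapRange_surjective g (map_zero g) hg

theorem map_exact {X Y Z : Type u} [AddCommGroup X] [Module ℂ X]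
    [Module (HeckeAlgebra b k) X] [IsScalarTower ℂ (HeckeAlgebra b k) X]
    [AddCommGroup Y] [Module ℂ Y] [Module (HeckeAlgebra b k) Y]
    [IsScalarTower ℂ (HeckeAlgebra b k) Y] [AddCommGroup Z] [Module ℂ Z]
    [Module (HeckeAlgebra b k) Z] [IsScalarTower ℂ (HeckeAlgebra b k) Z]
    {g : X →ₗ[HeckeAlgebra b k] Y} {p : Y →ₗ[HeckeAlgebra b k] Z}
    (h : Function.Exact g p) : Function.Exact (map hJ g) (map hJ p) := by
  have := finite_reflectionGroup P
  intro m
  constructor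
  · intro hm
    have h1 : ∀ c, ∃ x, g x =
        DFunLike.coe (F := (reflectionGroup P ⧸ parabolic P J) →₀ Y) m c := fun c => by
      refine (h _).mp ?_
      rw [← map_apply hJ p, hm]
      rfl
    choose x hx using h1
    exact ⟨Finsupp.equivFunOnFinite.symm x, Finsupp.ext hx⟩
  · rintro ⟨m, rfl⟩
    refine Finsupp.ext fun c => ?_
    rw [map_apply, map_apply, h.apply_apply_eq_zero]
    rfl

theorem proj_single {J K : Finset ι} (hJ : J ⊆ b.support) (hK : K ⊆ b.support) (hJK : J ⊆ K)
    (w : reflectionGroup P) (x : X) : proj hJ hK hJK k (single hJ w x) = single hK w x := by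
  change lsum hJ _ _ = _
  rw [lsum_single]
  congr 2
  exact QuotientGroup.eq.mpr (Subgroup.closure_mono (Set.image_mono (by exact_mod_cast hJK))
    (QuotientGroup.eq.mp (QuotientGroup.out_eq' (w : reflectionGroup P ⧸ parabolic P J))))

theorem proj_proj {J K L : Finset ι} (hJ : J ⊆ b.support) (hK : K ⊆ b.support)
    (hL : L ⊆ b.support) (hJK : J ⊆ K) (hKL : K ⊆ L) (m : Model hJ X) :
    proj hK hL hKL k (proj hJ hK hJK k m) = proj hJ hL (hJK.trans hKL) k m := by
  have : (proj hK hL hKL k (X := X)).restrictScalars ℂ ∘ₗ (proj hJ hK hJK k).restrictScalars ℂ =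
      (proj hJ hL (hJK.trans hKL) k).restrictScalars ℂ := hom_ext fun w x => by
    simp only [LinearMap.comp_apply, LinearMap.restrictScalars_apply, proj_single]
  exact LinearMap.congr_fun this m

theorem proj_surjective {J K : Finset ι} (hJ : J ⊆ b.support) (hK : K ⊆ b.support) (hJK : J ⊆ K)
    (k : Parameter b) [Module (HeckeAlgebra b k) X] [IsScalarTower ℂ (HeckeAlgebra b k) X] :
    Function.Surjective (proj hJ hK hJK k (X := X)) := by
  intro m
  have h2 : ((LinearMap.range (proj hJ hK hJK k (X := X))).restrictScalars ℂ).mkQ = 0 := by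
    refine hom_ext fun w x => ?_
    rw [LinearMap.zero_apply, Submodule.mkQ_apply, Submodule.Quotient.mk_eq_zero]
    exact ⟨single hJ w x, proj_single hJ hK hJK w x⟩
  have h3 := LinearMap.congr_fun h2 m
  rwa [LinearMap.zero_apply, Submodule.mkQ_apply, Submodule.Quotient.mk_eq_zero] at h3

theorem proj_self (hJ : J ⊆ b.support) (m : Model hJ X) :
    proj hJ hJ subset_rfl k m = m := by
  have : (proj hJ hJ subset_rfl k (X := X)).restrictScalars ℂ = LinearMap.id :=
    hom_ext fun w x => by
      rw [LinearMap.restrictScalars_apply, proj_single, LinearMap.id_apply]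
  exact LinearMap.congr_fun this m

end Model

end Comparison

/-! ### Classes in the Grothendieck group -/

section Classes

variable {A : Type u} [Ring A] [Algebra ℂ A]

theorem FDModule.cls_eq_add {X Y Z : FDModule A} (i : X.carrier →ₗ[A] Y.carrier)
    (p : Y.carrier →ₗ[A] Z.carrier) (hi : Function.Injective i) (h : Function.Exact i p)
    (hp : Function.Surjective p) : Y.cls = X.cls + Z.cls := by
  unfold FDModule.cls
  rw [← QuotientAddGroup.mk_add, eq_comm, QuotientAddGroup.eq, neg_add_eq_sub]
  exact AddSubgroup.subset_closure ⟨X, Y, Z, i, p, hi, h, hp, rfl⟩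

theorem FDModule.cls_eq_of_bijective {X Y : FDModule A} (g : X.carrier →ₗ[A] Y.carrier)
    (hg : Function.Bijective g) : X.cls = Y.cls := by
  let Z : FDModule A := { carrier := PUnit.{u+1} }
  have hZ : Z.cls = Z.cls + Z.cls := FDModule.cls_eq_add (0 : PUnit.{u+1} →ₗ[A] PUnit.{u+1})
    (0 : PUnit.{u+1} →ₗ[A] PUnit.{u+1}) (Function.injective_of_subsingleton _)
    (fun x => ⟨fun _ => ⟨0, rfl⟩, fun _ => rfl⟩) (fun x => ⟨0, rfl⟩)
  have h : Y.cls = X.cls + Z.cls := FDModule.cls_eq_add g (0 : Y.carrier →ₗ[A] PUnit.{u+1}) hg.1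
    (fun y => ⟨fun _ => hg.2 y, fun _ => rfl⟩) (fun x => ⟨0, rfl⟩)
  rw [h, left_eq_add.mp hZ, add_zero]

/-- A submodule of a finite-dimensional module. -/
@[reducible] noncomputable def FDModule.sub (X : FDModule A) (L : Submodule A X.carrier) :
    FDModule A :=
  { carrier := L
    finiteDimensional := inferInstanceAs (FiniteDimensional ℂ (L.restrictScalars ℂ)) }

theorem FDModule.cls_top (X : FDModule A) : (X.sub ⊤).cls = X.cls :=
  FDModule.cls_eq_of_bijective (X := X.sub ⊤) (⊤ : Submodule A X.carrier).subtype
    ⟨Subtype.val_injective, fun x => ⟨⟨x, trivial⟩, rfl⟩⟩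

/-- `[L] = [L ∩ ker p] + [p(L)]`. -/
theorem FDModule.cls_sub_eq_add {X Y : FDModule A} (p : X.carrier →ₗ[A] Y.carrier)
    {L K : Submodule A X.carrier} {L' : Submodule A Y.carrier} (hL : L.map p = L')
    (hK : L ⊓ LinearMap.ker p = K) : (X.sub L).cls = (X.sub K).cls + (Y.sub L').cls := by
  subst hL hK
  refine FDModule.cls_eq_add (X := X.sub _) (Y := X.sub L) (Z := Y.sub (L.map p))
    (Submodule.inclusion inf_le_left) (p.submoduleMap L) (Submodule.inclusion_injective _) ?_
    (p.submoduleMap_surjective L)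
  intro x
  constructor
  · intro hx
    exact ⟨⟨x.1, x.2, congrArg Subtype.val hx⟩, rfl⟩
  · rintro ⟨y, rfl⟩
    exact Subtype.ext y.2.2

end Classes

section Induction

variable {ι N : Type*} {V₀ : Type u} [AddCommGroup V₀] [Module ℝ V₀] [AddCommGroup N] [Module ℝ N]
variable {P : RootPairing ι ℝ V₀ N} {b : SimpleRoots P} {k : Parameter b}
variable [Finite ι] [P.IsReduced]

open HeckeAlgebra

/-- The model of `Ind Res X`, as a finite-dimensional module. -/
@[reducible] noncomputable def modelFD {J : Finset ι} (hJ : J ⊆ b.support)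
    (X : FDModule (HeckeAlgebra b k)) : FDModule (HeckeAlgebra b k) :=
  { carrier := Model hJ X.carrier }

theorem cls_indRes {J : Finset ι} (hJ : J ⊆ b.support) (X : FDModule (HeckeAlgebra b k)) :
    (indRes J X).cls = (modelFD hJ X).cls :=
  FDModule.cls_eq_of_bijective (X := indRes J X) (Y := modelFD hJ X) (Model.ofInd hJ k)
    (Model.ofInd_bijective hJ k)

/-- The functor `Ind Res` is exact: on the models it is given by functions on a finite set. -/
theorem cls_indRes_eq_add {J : Finset ι} (hJ : J ⊆ b.support) {X Y Z : FDModule (HeckeAlgebra b k)}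
    (i : X.carrier →ₗ[HeckeAlgebra b k] Y.carrier) (p : Y.carrier →ₗ[HeckeAlgebra b k] Z.carrier)
    (hi : Function.Injective i) (h : Function.Exact i p) (hp : Function.Surjective p) :
    (indRes J Y).cls = (indRes J X).cls + (indRes J Z).cls := by
  rw [cls_indRes hJ, cls_indRes hJ, cls_indRes hJ]
  exact FDModule.cls_eq_add (X := modelFD hJ X) (Y := modelFD hJ Y) (Z := modelFD hJ Z)
    (Model.map hJ i) (Model.map hJ p) (Model.map_injective hJ hi) (Model.map_exact hJ h)
    (Model.map_surjective hJ hp)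

/-- The endomorphism `[X] ↦ ∑_J (-1)^{|J|} [Ind Res X]` of the Grothendieck group. -/
noncomputable def alternatingInd (b : SimpleRoots P) (k : Parameter b) :
    Groth (HeckeAlgebra b k) →+ Groth (HeckeAlgebra b k) :=
  QuotientAddGroup.lift _ (FreeAbelianGroup.lift fun Y : FDModule (HeckeAlgebra b k) =>
    ∑ J ∈ b.support.powerset, (-1 : ℤ) ^ J.card • (indRes J Y).cls) <| by
    rw [AddSubgroup.closure_le]
    rintro _ ⟨X, Y, Z, i, p, hi, h, hp, rfl⟩
    rw [SetLike.mem_coe, AddMonoidHom.mem_ker, map_sub, map_add, FreeAbelianGroup.lift_apply_of,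
      FreeAbelianGroup.lift_apply_of, FreeAbelianGroup.lift_apply_of, sub_eq_zero,
      ← Finset.sum_add_distrib]
    refine Finset.sum_congr rfl fun J hJ => ?_
    rw [cls_indRes_eq_add (Finset.mem_powerset.mp hJ) i p hi h hp, smul_add]

theorem alternatingInd_cls (Y : FDModule (HeckeAlgebra b k)) :
    alternatingInd b k Y.cls =
      ∑ J ∈ b.support.powerset, (-1 : ℤ) ^ J.card • (indRes J Y).cls := by
  change FreeAbelianGroup.lift _ (FreeAbelianGroup.of Y) = _
  rw [FreeAbelianGroup.lift_apply_of]

end Induction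

/-! ### The alternating basis -/

section Basis

variable {ι N : Type*} {V₀ : Type u} [AddCommGroup V₀] [Module ℝ V₀] [AddCommGroup N] [Module ℝ N]
variable {P : RootPairing ι ℝ V₀ N} {b : SimpleRoots P} {k : Parameter b}

open HeckeAlgebra Classical

variable (b) in
/-- The right descent set of `w`: the simple roots that `w` makes negative. -/
noncomputable def descents (w : reflectionGroup P) : Finset ι :=
  b.support.filter fun α => -(w.1 (P.root α)) ∈ b.posRoots

theorem descents_subset (w : reflectionGroup P) : descents b w ⊆ b.support :=
  Finset.filter_subset _ _

theorem refl_mem_parabolic {J : Finset ι} {α : ι} (hα : α ∈ J) : refl P α ∈ parabolic P J :=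
  Subgroup.subset_closure ⟨α, hα, rfl⟩

/-- An alternating sum of a function that is invariant under right multiplication with a reflection
vanishes. -/
theorem sum_sgn_smul_eq_zero [Fintype (reflectionGroup P)] {E : Type*} [AddCommGroup E] [Module ℂ E]
    (F : reflectionGroup P → E) (i : ι) (hF : ∀ u, F (u * refl P i) = F u) :
    ∑ u, sgn P u • F u = 0 := by
  have h : ∑ u, sgn P u • F u = -∑ u, sgn P u • F u := by
    conv_lhs => rw [← Equiv.sum_comp (Equiv.mulRight (refl P i))]
    rw [← Finset.sum_neg_distrib]
    refine Finset.sum_congr rfl fun u _ => ?_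
    rw [Equiv.coe_mulRight, hF, map_mul, sgn_refl, mul_neg, mul_one, neg_smul]
  have h2 : (2 : ℂ) • ∑ u, sgn P u • F u = 0 := by
    rw [two_smul]
    nth_rewrite 1 [h]
    rw [neg_add_cancel]
  exact (smul_eq_zero.mp h2).resolve_left two_ne_zero

namespace Model

variable {X : Type u} [AddCommGroup X] [Module ℂ X]

/-- The value of a function in the model at a coset. -/
noncomputable def coord {J : Finset ι} (hJ : J ⊆ b.support)
    (c : reflectionGroup P ⧸ parabolic P J) : Model hJ X →ₗ[ℂ] X :=
  Finsupp.lapply c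

theorem coord_single {J : Finset ι} (hJ : J ⊆ b.support) (c c' : reflectionGroup P ⧸ parabolic P J)
    (x : X) : coord hJ c (single hJ c' x) = if c' = c then x else 0 :=
  Finsupp.single_apply

theorem mk_eq_mk_empty {w w' : reflectionGroup P} :
    (w : reflectionGroup P ⧸ parabolic P ∅) = w' ↔ w = w' := by
  rw [QuotientGroup.eq, parabolic, Finset.coe_empty, Set.image_empty, Subgroup.closure_empty,
    Subgroup.mem_bot, inv_mul_eq_one]

variable [Fintype (reflectionGroup P)]

/-- The embedding `x ↦ ∑ sgn(w) t_w ⊗ t_w⁻¹ x` onto the intersection of the kernels of the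
projections for all simple roots. -/
noncomputable def signEmb (b : SimpleRoots P) (X : Type u) [AddCommGroup X] [Module ℂ X] :
    X →ₗ[ℂ] Model (Finset.empty_subset b.support) X :=
  ∑ w : reflectionGroup P, sgn P w • single (Finset.empty_subset b.support) w

theorem signEmb_apply (x : X) : signEmb b X x =
    ∑ w : reflectionGroup P, sgn P w • single (Finset.empty_subset b.support) w x := by
  simp [signEmb]

theorem coord_signEmb (w : reflectionGroup P) (x : X) :
    coord (Finset.empty_subset b.support) w (signEmb b X x) = sgn P w • x := by
  rw [signEmb_apply, map_sum, Finset.sum_eq_single w]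
  · rw [map_smul, coord_single, if_pos rfl]
  · intro w' _ hne
    rw [map_smul, coord_single, if_neg fun h => hne (mk_eq_mk_empty.mp h), smul_zero]
  · intro h; exact absurd (Finset.mem_univ _) h

theorem signEmb_injective : Function.Injective (signEmb b X) := by
  intro x y h
  have := congrArg (coord (Finset.empty_subset b.support)
    ((1 : reflectionGroup P) : reflectionGroup P ⧸ parabolic P ∅)) h
  simpa only [coord_signEmb, map_one, one_smul] using this

variable (b) in
/-- The combination `∑ b_w ⊗ c(w)`, where `b_w = ∑ sgn(u) w u` with `u` running over the parabolic
subgroup generated by the descents of `w`. -/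
noncomputable def altSum (c : reflectionGroup P → X) : Model (Finset.empty_subset b.support) X :=
  ∑ w, ∑ u, if u ∈ parabolic P (descents b w) then
    sgn P u • single (Finset.empty_subset b.support) (w * u : reflectionGroup P) (c w) else 0

theorem altSum_add (c c' : reflectionGroup P → X) :
    altSum b (c + c') = altSum b c + altSum b c' := by
  unfold altSum
  rw [← Finset.sum_add_distrib]
  refine Finset.sum_congr rfl fun w _ => ?_
  rw [← Finset.sum_add_distrib]
  refine Finset.sum_congr rfl fun u _ => ?_
  split_ifs
  · rw [Pi.add_apply, map_add, smul_add]
  · rw [add_zero]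

theorem altSum_smul (z : ℂ) (c : reflectionGroup P → X) :
    altSum b (z • c) = z • altSum b c := by
  unfold altSum
  rw [Finset.smul_sum]
  refine Finset.sum_congr rfl fun w _ => ?_
  rw [Finset.smul_sum]
  refine Finset.sum_congr rfl fun u _ => ?_
  split_ifs
  · rw [Pi.smul_apply, map_smul, smul_comm]
  · rw [smul_zero]

variable [Module (HeckeAlgebra b k) X] [IsScalarTower ℂ (HeckeAlgebra b k) X]
variable [Finite ι] [P.IsReduced]

theorem proj_altSum {J : Finset ι} (hJ : J ⊆ b.support) (c : reflectionGroup P → X) :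
    proj (Finset.empty_subset b.support) hJ (Finset.empty_subset J) k (altSum b c) =
      ∑ w, ∑ u, if u ∈ parabolic P (descents b w) then
        sgn P u • single hJ (w * u : reflectionGroup P) (c w) else 0 := by
  change (proj _ _ (Finset.empty_subset J) k).restrictScalars ℂ _ = _
  unfold altSum
  simp only [map_sum, apply_ite ((proj _ _ (Finset.empty_subset J) k).restrictScalars ℂ),
    map_smul, map_zero]
  simp only [LinearMap.restrictScalars_apply, proj_single]

/-- If a descent of `w` lies in `J`, then `b_w` vanishes in the model for `J`. -/
theorem proj_altSum_eq_zero {J : Finset ι} (hJ : J ⊆ b.support) {c : reflectionGroup P → X}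
    (hc : ∀ w, Disjoint (descents b w) J → c w = 0) :
    proj (Finset.empty_subset b.support) hJ (Finset.empty_subset J) k (altSum b c) = 0 := by
  rw [proj_altSum]
  refine Finset.sum_eq_zero fun w _ => ?_
  by_cases hw : Disjoint (descents b w) J
  · rw [hc w hw]
    simp
  obtain ⟨α, hα, hαJ⟩ := Finset.not_disjoint_iff.mp hw
  have h := sum_sgn_smul_eq_zero (fun u => if u ∈ parabolic P (descents b w) then
    single hJ (w * u : reflectionGroup P) (c w) else 0) α (fun u => by
      have h1 : ((w * (u * refl P α) : reflectionGroup P) : reflectionGroup P ⧸ parabolic P J) =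
          (w * u : reflectionGroup P) := by
        rw [eq_comm, QuotientGroup.eq, ← mul_assoc w, inv_mul_cancel_left]
        exact refl_mem_parabolic hαJ
      rw [h1]
      congr 1
      exact propext (Subgroup.mul_mem_cancel_right _ (refl_mem_parabolic hα)))
  simpa only [smul_ite, smul_zero] using h

/-- The family `b_w` is unitriangular for the length: `w` is the longest element occurring in `b_w`,
and if no descent of `w` lies in `J`, then `w` is the shortest element of `w W_J`. -/
theorem eq_zero_of_proj_altSum_eq_zero {J : Finset ι} (hJ : J ⊆ b.support)
    {c : reflectionGroup P → X} (hc : ∀ w, ¬ Disjoint (descents b w) J → c w = 0)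
    (h : proj (Finset.empty_subset b.support) hJ (Finset.empty_subset J) k (altSum b c) = 0) :
    c = 0 := by
  by_contra hne
  -- At a longest `w` with `c w ≠ 0`, only `b_w` itself contributes to the coordinate at `w W_J`.
  obtain ⟨w₁, hw₁⟩ := Function.ne_iff.mp hne
  obtain ⟨w, hw, hmax⟩ := Set.exists_max_image {w | c w ≠ 0} b.length (Set.toFinite _) ⟨w₁, hw₁⟩
  apply hw
  have hdis : Disjoint (descents b w) J := by
    by_contra hcon
    exact hw (hc w hcon)
  have hshort : ∀ y ∈ parabolic P J, y ≠ 1 → b.length w < b.length (w * y) := by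
    intro y hy hy1
    refine length_lt_of_pos b hJ (fun α hα => ?_) hy hy1
    rcases mem_or_neg_mem b (apply_mem_range w (simple_mem b (hJ hα)).1) with h1 | h1
    · exact h1
    · exact absurd hα (Finset.disjoint_left.mp hdis (Finset.mem_filter.mpr ⟨hJ hα, h1⟩))
  have hlong : ∀ w' : reflectionGroup P, ∀ u ∈ parabolic P (descents b w'), u ≠ 1 →
      b.length (w' * u) < b.length w' := fun w' u hu hu1 =>
    length_lt_of_neg b (descents_subset w') (fun α hα => (Finset.mem_filter.mp hα).2) hu hu1
  rw [proj_altSum] at h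
  have h2 := congrArg (coord hJ (w : reflectionGroup P ⧸ parabolic P J)) h
  simp only [map_sum, apply_ite (coord hJ (w : reflectionGroup P ⧸ parabolic P J)), map_smul,
    map_zero, coord_single] at h2
  rw [Finset.sum_eq_single w, Finset.sum_eq_single 1] at h2
  · simpa [one_mem] using h2
  · intro u _ hu
    split_ifs with h3 h4
    · exfalso
      rw [eq_comm, QuotientGroup.eq, inv_mul_cancel_left] at h4
      exact absurd (hshort u h4 hu) (not_lt.mpr (hlong w u h3 hu).le)
    · rw [smul_zero]
    · rfl
  · intro h3; exact absurd (Finset.mem_univ _) h3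
  · intro w' _ hne'
    refine Finset.sum_eq_zero fun u _ => ?_
    split_ifs with h3 h4
    · by_cases hcw : c w' = 0
      · rw [hcw, smul_zero]
      exfalso
      rw [eq_comm, QuotientGroup.eq] at h4
      have hle : b.length (w' * u) ≤ b.length w' := by
        by_cases hu : u = 1
        · rw [hu, mul_one]
        · exact (hlong w' u h3 hu).le
      have hle' := hmax w' hcw
      by_cases hy : w⁻¹ * (w' * u) = 1
      · have h5 : w' * u = w := (inv_mul_eq_one.mp hy).symm
        by_cases hu : u = 1
        · exact hne' (by rw [← h5, hu, mul_one])
        · have := hlong w' u h3 hu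
          rw [h5] at this
          omega
      · have := hshort _ h4 hy
        rw [mul_inv_cancel_left] at this
        omega
    · rw [smul_zero]
    · rfl
  · intro h3; exact absurd (Finset.mem_univ _) h3

theorem proj_altSum_eq_zero_iff {J : Finset ι} (hJ : J ⊆ b.support) {c : reflectionGroup P → X} :
    proj (Finset.empty_subset b.support) hJ (Finset.empty_subset J) k (altSum b c) = 0 ↔
      ∀ w, Disjoint (descents b w) J → c w = 0 := by
  refine ⟨fun h w hw => ?_, proj_altSum_eq_zero hJ⟩
  let c₁ : reflectionGroup P → X := fun w => if Disjoint (descents b w) J then 0 else c w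
  let c₂ : reflectionGroup P → X := fun w => if Disjoint (descents b w) J then c w else 0
  have hc : c = c₁ + c₂ := funext fun w => by
    simp only [Pi.add_apply, c₁, c₂]
    split_ifs <;> simp
  rw [hc, altSum_add, map_add, proj_altSum_eq_zero hJ (fun w hw => if_pos hw), zero_add] at h
  have h2 := congrFun (eq_zero_of_proj_altSum_eq_zero hJ (fun w hw => if_neg hw) h) w
  simpa [c₂, hw] using h2

/-- The elements `b_w` form a basis: they are as many as the elements of `W`, and independent by
unitriangularity. -/
theorem altSum_surjective [FiniteDimensional ℂ X] (k : Parameter b) [Module (HeckeAlgebra b k) X]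
    [IsScalarTower ℂ (HeckeAlgebra b k) X] : Function.Surjective (altSum b (X := X)) := by
  let e : Model (Finset.empty_subset b.support) X →ₗ[ℂ] (reflectionGroup P → X) :=
    LinearMap.pi fun w => coord _ (w : reflectionGroup P ⧸ parabolic P ∅)
  have he : Function.Injective e := fun m m' h => Finsupp.ext fun c => by
    obtain ⟨w, rfl⟩ := QuotientGroup.mk_surjective c
    exact congrFun h w
  let g : (reflectionGroup P → X) →ₗ[ℂ] (reflectionGroup P → X) :=
    e ∘ₗ { toFun := altSum b, map_add' := altSum_add, map_smul' := altSum_smul }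
  have hg : Function.Injective g := by
    rw [injective_iff_map_eq_zero]
    intro c hc
    have h1 : altSum b c = 0 := he (by rw [map_zero]; exact hc)
    refine eq_zero_of_proj_altSum_eq_zero (k := k) (Finset.empty_subset b.support)
      (fun w hw => absurd (Finset.disjoint_empty_right _) hw) ?_
    rw [h1, map_zero]
  intro m
  obtain ⟨c, hc⟩ := (LinearMap.injective_iff_surjective.mp hg) (e m)
  exact ⟨c, he hc⟩

/-- The kernels `N_β` of the projections for single simple roots `β` satisfy
`(⋂_{β ∈ S} N_β) ∩ (N_α + N_T) ⊆ (⋂_{β ∈ S ∪ {α}} N_β) + N_T`, where `N_T` is the sum of the `N_β`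
with `β ∈ T`. This distributivity holds because all these subspaces are spanned by parts of the
basis `b_w`. -/
theorem exists_proj_eq [FiniteDimensional ℂ X] {S T : Finset ι} {α : ι} (hT : T ⊆ b.support)
    (hαT : insert α T ⊆ b.support)
    {m : Model (Finset.empty_subset b.support) X}
    (hm : ∀ β ∈ S, ∀ hβ : {β} ⊆ b.support, proj _ hβ (Finset.empty_subset _) k m = 0)
    (hm' : proj _ hαT (Finset.empty_subset _) k m = 0) :
    ∃ m' : Model (Finset.empty_subset b.support) X,
      (∀ β ∈ insert α S, ∀ hβ : {β} ⊆ b.support, proj _ hβ (Finset.empty_subset _) k m' = 0) ∧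
      proj _ hT (Finset.empty_subset _) k m' = proj _ hT (Finset.empty_subset _) k m := by
  obtain ⟨c, rfl⟩ := altSum_surjective k m
  let c₁ : reflectionGroup P → X := fun w => if α ∈ descents b w then c w else 0
  let c₂ : reflectionGroup P → X := fun w => if α ∈ descents b w then 0 else c w
  have hc : c = c₁ + c₂ := funext fun w => by
    simp only [Pi.add_apply, c₁, c₂]
    split_ifs <;> simp
  rw [proj_altSum_eq_zero_iff] at hm'
  refine ⟨altSum b c₁, fun β hβ hβ' => proj_altSum_eq_zero hβ' fun w hw => ?_, ?_⟩
  · rw [Finset.disjoint_singleton_right] at hw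
    rcases Finset.mem_insert.mp hβ with rfl | hβ
    · exact if_neg hw
    · have h := (proj_altSum_eq_zero_iff hβ').mp (hm β hβ hβ') w
        (Finset.disjoint_singleton_right.mpr hw)
      simp only [c₁, h, ite_self]
  · rw [hc, altSum_add, map_add, proj_altSum_eq_zero (k := k) hT (c := c₂), add_zero]
    intro w hw
    by_cases h : α ∈ descents b w
    · exact if_pos h
    · have h2 := hm' w (Finset.disjoint_insert_right.mpr ⟨h, hw⟩)
      simp only [c₂, h2, ite_self]

end Model

end Basis

/-! ### The sign submodule and the dual -/

section SignSubmodule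

variable {ι N : Type*} {V₀ : Type u} [AddCommGroup V₀] [Module ℝ V₀] [AddCommGroup N] [Module ℝ N]
variable {P : RootPairing ι ℝ V₀ N} {b : SimpleRoots P} {k : Parameter b}
variable [Finite ι] [P.IsReduced]

open HeckeAlgebra Classical

theorem sgn_mul_self (b : SimpleRoots P) (w : reflectionGroup P) : sgn P w * sgn P w = 1 := by
  obtain ⟨L, rfl⟩ := exists_list b w
  induction L with
  | nil => simp
  | cons α L ih =>
    rw [List.map_cons, List.prod_cons, map_mul, mul_mul_mul_comm, ih, sgn_refl]
    norm_num

theorem sgn_inv (b : SimpleRoots P) (w : reflectionGroup P) : sgn P w⁻¹ = sgn P w := by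
  rw [← mul_one (sgn P w⁻¹), ← sgn_mul_self b w, ← mul_assoc, ← map_mul, inv_mul_cancel, map_one,
    one_mul]

namespace HeckeAlgebra

/-- The cross relation for an arbitrary `t_w`. -/
theorem t_mul_f (w : reflectionGroup P) (v : ℂ ⊗[ℝ] V₀) :
    t b k w * f b k v = f b k (act w v) * t b k w -
      k.inversionSum w (act w v) fun i => t b k (refl P i) * t b k w := by
  obtain ⟨L, rfl⟩ := exists_list b w
  induction L with
  | nil => rw [List.map_nil, List.prod_nil, act_one, k.inversionSum_one, map_one, one_mul, mul_one,
      sub_zero]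
  | cons α L ih =>
    rw [List.map_cons, List.prod_cons]
    set u := (L.map fun a : b.support => refl P a).prod
    have h := k.inversionSum_refl_mul α u (act u v) fun g => t b k g * t b k u
    have h2 := cross (k := k) α (act u v)
    rw [sub_eq_iff_eq_add'] at h2
    have h3 := k.map_inversionSum (LinearMap.mulLeft ℂ (t b k (refl P α))) u (act u v)
      fun i => t b k (refl P i) * t b k u
    simp only [LinearMap.mulLeft_apply, ← mul_assoc] at h3
    simp only [map_mul, map_one, one_mul] at h
    rw [map_mul, mul_assoc, ih, mul_sub, ← mul_assoc, h2, h3, h, add_mul, ← Algebra.smul_def,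
      act_mul, mul_assoc]
    simp only [mul_assoc]
    abel

/-- The twist occurring in the dual `𝔻(X)`: the composition of the anti-involution `•`, the
involution `ι` and the anti-involution `*`. -/
noncomputable def dualTwist (b : SimpleRoots P) (k : Parameter b) :
    HeckeAlgebra b k →ₐ[ℂ] HeckeAlgebra b k :=
  (AlgHom.opComm (bullet b k)).comp ((AlgHom.op (iota b k)).comp (star b k))

theorem dualTwist_apply (h : HeckeAlgebra b k) : dualTwist b k h =
    MulOpposite.unop (bullet b k (iota b k (MulOpposite.unop (star b k h)))) := rfl

theorem dualTwist_t (w : reflectionGroup P) : dualTwist b k (t b k w) = sgn P w • t b k w := by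
  rw [dualTwist_apply, star_t, MulOpposite.unop_op, iota_t, map_smul, bullet_t, inv_inv,
    sgn_inv b, MulOpposite.unop_smul, MulOpposite.unop_op]

theorem dualTwist_f (v : ℂ ⊗[ℝ] V₀) : dualTwist b k (f b k v) =
    t b k b.longest * f b k (act b.longest v) * t b k b.longest⁻¹ := by
  rw [dualTwist_apply, star_f, MulOpposite.unop_op, theta_f, map_mul (iota b k),
    map_mul (iota b k), iota_t, iota_t,
    iota_f, map_neg, neg_neg, smul_mul_assoc, smul_mul_smul_comm, sgn_inv b, sgn_mul_self b,
    one_smul, map_mul (bullet b k),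
    map_mul (bullet b k), bullet_t, bullet_t, bullet_f]
  simp only [MulOpposite.unop_mul, MulOpposite.unop_op, inv_inv, mul_assoc]

end HeckeAlgebra

namespace Model

variable {X : Type u} [AddCommGroup X] [Module ℂ X]
variable [Module (HeckeAlgebra b k) X] [IsScalarTower ℂ (HeckeAlgebra b k) X]
/-- The intersection of the kernels of the projections to the models for single simple roots in
`S`. -/
noncomputable def kerInf (k : Parameter b) (X : Type u) [AddCommGroup X] [Module ℂ X]
    [Module (HeckeAlgebra b k) X] [IsScalarTower ℂ (HeckeAlgebra b k) X] (S : Finset ι) :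
    Submodule (HeckeAlgebra b k) (Model (Finset.empty_subset b.support) X) :=
  ⨅ β ∈ S, ⨅ hβ : {β} ⊆ b.support,
    LinearMap.ker (proj (Finset.empty_subset b.support) hβ (Finset.empty_subset _) k)

theorem mem_kerInf {S : Finset ι} {m : Model (Finset.empty_subset b.support) X} :
    m ∈ kerInf k X S ↔ ∀ β ∈ S, ∀ hβ : {β} ⊆ b.support,
      proj _ hβ (Finset.empty_subset _) k m = 0 := by
  simp only [kerInf, Submodule.mem_iInf, LinearMap.mem_ker]

variable [Fintype (reflectionGroup P)]

theorem signEmb_mem (S : Finset ι) (x : X) : signEmb b X x ∈ kerInf k X S := by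
  rw [mem_kerInf]
  intro β _ hβ
  rw [signEmb_apply, map_sum]
  simp only [LinearMap.map_smul_of_tower, proj_single]
  have hF : ∀ u : reflectionGroup P,
      single hβ ((u * refl P β : reflectionGroup P) : reflectionGroup P ⧸ parabolic P {β}) x =
        single hβ (u : reflectionGroup P ⧸ parabolic P {β}) x := fun u => by
    have h : ((u * refl P β : reflectionGroup P) : reflectionGroup P ⧸ parabolic P {β}) = u := by
      rw [eq_comm, QuotientGroup.eq, inv_mul_cancel_left]
      exact refl_mem_parabolic (Finset.mem_singleton_self β)
    rw [h]
  exact sum_sgn_smul_eq_zero _ β hF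

/-- Only those `b_w` for which every simple root is a descent lie in all the kernels, and for them
the parabolic subgroup is all of `W`. -/
theorem exists_signEmb_eq [FiniteDimensional ℂ X] {m : Model (Finset.empty_subset b.support) X}
    (hm : m ∈ kerInf k X b.support) : ∃ x, signEmb b X x = m := by
  obtain ⟨c, rfl⟩ := altSum_surjective k m
  rw [mem_kerInf] at hm
  have hc : ∀ w, descents b w ≠ b.support → c w = 0 := by
    intro w hw
    obtain ⟨β, hβ, hβw⟩ := Finset.exists_of_ssubset ((descents_subset w).ssubset_of_ne hw)
    exact (proj_altSum_eq_zero_iff (Finset.singleton_subset_iff.mpr hβ)).mp (hm β hβ _) w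
      (Finset.disjoint_singleton_right.mpr hβw)
  refine ⟨∑ w, sgn P w • c w, ?_⟩
  rw [map_sum]
  refine Finset.sum_congr rfl fun w _ => ?_
  by_cases hw : descents b w = b.support
  swap
  · rw [hc w hw]
    simp
  rw [hw, parabolic, closure_simple b, map_smul, signEmb_apply,
    ← Equiv.sum_comp (Equiv.mulLeft w), Finset.smul_sum]
  refine Finset.sum_congr rfl fun u _ => ?_
  rw [if_pos (Subgroup.mem_top u), Equiv.coe_mulLeft, map_mul, smul_smul, ← mul_assoc,
    sgn_mul_self b, one_mul]

/-- On the image of `signEmb`, the algebra acts through the twist. To find the action of `v`, it is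
enough to look at the coordinate at the longest element, since no term of `v t_w` with `w ≠ w₀`
contributes to it. -/
theorem signEmb_smul [FiniteDimensional ℂ X] (h : HeckeAlgebra b k) (x : X) :
    signEmb b X (dualTwist b k h • x) = h • signEmb b X x := by
  refine map_smul_of_generators (dualTwist b k) (signEmb b X) (fun w x => ?_) (fun v x => ?_) h x
  · rw [dualTwist_t, signEmb_apply, signEmb_apply, Finset.smul_sum,
      ← Equiv.sum_comp (Equiv.mulLeft w)]
    refine Finset.sum_congr rfl fun u _ => ?_
    have h1 := (Algebra.lsmul ℂ ℂ (Model (Finset.empty_subset b.support) X) (t b k w)).map_smul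
      (sgn P u) (single _ (u : reflectionGroup P ⧸ parabolic P ∅) x)
    simp only [Algebra.lsmul_coe] at h1
    rw [h1, t_smul_single, Equiv.coe_mulLeft, map_mul, smul_assoc, map_smul, smul_smul,
      mul_right_comm, sgn_mul_self b, one_mul]
  · obtain ⟨y, hy⟩ := exists_signEmb_eq
      (Submodule.smul_mem _ (f b k v) (signEmb_mem (k := k) b.support x))
    rw [← hy]
    congr 1
    have h1 := congrArg (coord (Finset.empty_subset b.support)
      (b.longest : reflectionGroup P ⧸ parabolic P ∅)) hy
    have h2 : f b k v • signEmb b X x = ∑ w : reflectionGroup P, sgn P w •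
        f b k v • single (Finset.empty_subset b.support) w x := by
      rw [signEmb_apply, Finset.smul_sum]
      exact Finset.sum_congr rfl fun u _ => (Algebra.lsmul ℂ ℂ
        (Model (Finset.empty_subset b.support) X) (f b k v)).map_smul _ _
    rw [coord_signEmb, h2, map_sum, Finset.sum_eq_single b.longest] at h1
    · rw [map_smul] at h1
      have h3 := congrArg (fun z => sgn P b.longest • z) h1
      simp only [smul_smul, sgn_mul_self b, one_smul] at h3
      rw [h3, f_smul_single, map_add, k.map_inversionSum, coord_single, if_pos rfl, dualTwist_f,
        t_mul_f, ← act_mul, longest_mul_self, act_one, sub_mul, mul_assoc, ← map_mul,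
        mul_inv_cancel, map_one, mul_one, sub_smul, sub_eq_add_neg]
      congr 1
      have h4 := k.map_inversionSum ((LinearMap.mulRight ℂ (t b k b.longest⁻¹)))
        b.longest v (fun i => t b k (refl P i) * t b k b.longest)
      have h5 := k.map_inversionSum
        (-(LinearMap.toSpanSingleton (HeckeAlgebra b k) X x).restrictScalars ℂ) b.longest v
        (fun i => t b k (refl P i))
      simp only [LinearMap.mulRight_apply, mul_assoc, ← map_mul (t b k), mul_inv_cancel,
        mul_one] at h4
      simp only [LinearMap.neg_apply, LinearMap.restrictScalars_apply,
        LinearMap.toSpanSingleton_apply] at h5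
      simp only [← map_mul (t b k)]
      rw [h4, h5]
      refine k.inversionSum_congr _ _ fun i _ => ?_
      rw [map_sub, coord_single, coord_single, if_pos rfl, if_neg, zero_sub]
      intro hi
      have h6 := congrArg (sgn P) (mul_eq_right.mp (mk_eq_mk_empty.mp hi))
      rw [sgn_refl, map_one] at h6
      norm_num at h6
    · intro w _ hne
      rw [map_smul, f_smul_single, map_add, k.map_inversionSum, coord_single,
        if_neg fun h => hne (mk_eq_mk_empty.mp h), zero_add]
      rw [k.inversionSum_congr (F' := fun _ => (0 : X)), k.inversionSum_zero, smul_zero]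
      intro i hi
      rw [map_sub, coord_single, coord_single, if_neg fun h => hne (mk_eq_mk_empty.mp h), sub_zero,
        if_neg]
      intro h3
      have h4 := mk_eq_mk_empty.mp h3
      have h5 : w⁻¹ = b.longest * refl P i := by
        rw [← longest_inv b, ← h4, mul_inv_rev, refl_inv, mul_assoc, refl_mul_self, mul_one]
      have h6 := hi.2
      rw [h5] at h6
      change -(b.longest.1 (P.reflection i (P.root i))) ∈ _ at h6
      rw [P.reflection_apply_self, map_neg, neg_neg] at h6
      exact neg_notMem b h6 (neg_longest_pos b hi.1)
    · intro h3; exact absurd (Finset.mem_univ _) h3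

end Model

end SignSubmodule

/-! ### The alternating sum of the induced modules -/

section AlternatingSum

variable {ι N : Type*} {V₀ : Type u} [AddCommGroup V₀] [Module ℝ V₀] [AddCommGroup N] [Module ℝ N]
variable {P : RootPairing ι ℝ V₀ N} {b : SimpleRoots P} {k : Parameter b}
variable [Finite ι] [P.IsReduced]

open HeckeAlgebra Classical

/-- The image, in the model for `T`, of the intersection of the kernels of the projections to the
models for the simple roots in `S`. -/
@[reducible] noncomputable def kerInfImage (S : Finset ι) {T : Finset ι} (hT : T ⊆ b.support)
    (X : FDModule (HeckeAlgebra b k)) : FDModule (HeckeAlgebra b k) :=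
  (modelFD hT X).sub ((Model.kerInf k X.carrier S).map
    (Model.proj (Finset.empty_subset b.support) hT (Finset.empty_subset T) k))

/-- Passing to one more simple root in `T` and in `S` gives a subquotient decomposition. -/
theorem cls_kerInfImage (S : Finset ι) {T : Finset ι} (hT : T ⊆ b.support) {α : ι}
    (hα : insert α T ⊆ b.support) (X : FDModule (HeckeAlgebra b k)) :
    (kerInfImage S hT X).cls =
      (kerInfImage (insert α S) hT X).cls + (kerInfImage S hα X).cls := by
  have := finite_reflectionGroup P
  have := Fintype.ofFinite (reflectionGroup P)
  have hα' : {α} ⊆ b.support :=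
    Finset.singleton_subset_iff.mpr (hα (Finset.mem_insert_self α T))
  refine FDModule.cls_sub_eq_add (X := modelFD hT X) (Y := modelFD hα X)
    (Model.proj hT hα (Finset.subset_insert α T) k) ?_ ?_
  · rw [← Submodule.map_comp]
    congr 1
    exact LinearMap.ext fun m => Model.proj_proj _ hT hα _ (Finset.subset_insert α T) m
  · ext z
    constructor
    · rintro ⟨⟨m, hm, rfl⟩, hz⟩
      rw [SetLike.mem_coe, LinearMap.mem_ker, Model.proj_proj] at hz
      obtain ⟨m', h1, h2⟩ := Model.exists_proj_eq hT hα (Model.mem_kerInf.mp hm) hz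
      exact ⟨m', Model.mem_kerInf.mpr h1, h2⟩
    · rintro ⟨m, hm, rfl⟩
      have hm := Model.mem_kerInf.mp hm
      refine ⟨⟨m, Model.mem_kerInf.mpr fun β hβ => hm β (Finset.mem_insert_of_mem hβ), rfl⟩, ?_⟩
      rw [SetLike.mem_coe, LinearMap.mem_ker, Model.proj_proj, ← Model.proj_proj _ hα' hα
        (Finset.empty_subset _) (Finset.singleton_subset_iff.mpr (Finset.mem_insert_self α T)),
        hm α (Finset.mem_insert_self α S), map_zero]

/-- An inclusion-exclusion formula, by induction on `S`. -/
theorem sum_cls_indRes {S : Finset ι} (hS : S ⊆ b.support) {T : Finset ι} (hT : T ⊆ b.support)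
    (X : FDModule (HeckeAlgebra b k)) :
    ∑ J ∈ S.powerset, (-1 : ℤ) ^ J.card • (indRes (T ∪ J) X).cls = (kerInfImage S hT X).cls := by
  induction S using Finset.induction_on generalizing T with
  | empty =>
    rw [Finset.powerset_empty, Finset.sum_singleton, Finset.card_empty, pow_zero, one_smul,
      Finset.union_empty, cls_indRes hT, ← FDModule.cls_top]
    congr 2
    rw [Model.kerInf]
    simp only [Finset.notMem_empty, iInf_false, iInf_top, Submodule.map_top]
    exact (LinearMap.range_eq_top.mpr (Model.proj_surjective _ hT _ k)).symm
  | insert α S hα ih =>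
    have hS' := (Finset.subset_insert α S).trans hS
    have hαT : insert α T ⊆ b.support :=
      Finset.insert_subset (hS (Finset.mem_insert_self α S)) hT
    rw [Finset.sum_powerset_insert hα, ih hS' hT, cls_kerInfImage S hT hαT, add_assoc,
      add_eq_left, ← ih hS' hαT, ← Finset.sum_add_distrib]
    refine Finset.sum_eq_zero fun J hJ => ?_
    have hJα : α ∉ J := fun h => hα (Finset.mem_powerset.mp hJ h)
    rw [Finset.card_insert_of_notMem hJα, Finset.union_insert, ← Finset.insert_union, pow_succ,
      mul_neg_one, neg_smul, add_neg_cancel]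

/-- The dual `𝔻(X)` is the twist of `X` by `dualTwist`, under evaluation. -/
theorem cls_D (X : FDModule (HeckeAlgebra b k)) :
    (D X).cls = (X.twist (dualTwist b k)).cls := by
  let e : (X.twist (dualTwist b k)).carrier →ₗ[HeckeAlgebra b k] (D X).carrier :=
    { toFun := Module.Dual.eval ℂ X.carrier
      map_add' := map_add (Module.Dual.eval ℂ X.carrier)
      map_smul' := fun h x => rfl }
  exact (FDModule.cls_eq_of_bijective e (Module.bijective_dual_eval ℂ X.carrier)).symm

/-- The case `S = Π`, `T = ∅` of the inclusion-exclusion formula: the twisted module is the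
intersection of all the kernels. -/
theorem cls_D_eq (X : FDModule (HeckeAlgebra b k)) :
    (D X).cls = alternatingInd b k X.cls := by
  have := finite_reflectionGroup P
  have := Fintype.ofFinite (reflectionGroup P)
  have h := sum_cls_indRes subset_rfl (Finset.empty_subset b.support) X
  simp only [Finset.empty_union] at h
  rw [cls_D, alternatingInd_cls, h]
  have hmem : ∀ x : X.carrier, Model.signEmb b X.carrier x ∈
      (Model.kerInf k X.carrier b.support).map
        (Model.proj (Finset.empty_subset b.support) (Finset.empty_subset b.support)
        (Finset.empty_subset ∅) k) := fun x =>
    ⟨_, Model.signEmb_mem _ x, Model.proj_self _ _⟩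
  let g : (X.twist (dualTwist b k)).carrier →ₗ[HeckeAlgebra b k]
      (kerInfImage b.support (Finset.empty_subset b.support) X).carrier :=
    { toFun := fun x => ⟨Model.signEmb b X.carrier x, hmem x⟩
      map_add' := fun x y => Subtype.ext (map_add _ _ _)
      map_smul' := fun h x => Subtype.ext (Model.signEmb_smul (X := X.carrier) h x) }
  refine FDModule.cls_eq_of_bijective g ⟨fun x y hxy => ?_, ?_⟩
  · exact Model.signEmb_injective (congrArg Subtype.val hxy)
  · rintro ⟨_, m, hm, rfl⟩
    obtain ⟨x, rfl⟩ := Model.exists_signEmb_eq hm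
    exact ⟨x, Subtype.ext (Model.proj_self _ _).symm⟩

end AlternatingSum

/-! ### Irreducible modules are finite-dimensional -/

/-- A nonzero finite module over a commutative algebra of finite type has a proper submodule of
finite codimension, by the Nullstellensatz. -/
theorem exists_ne_top_finite_quotient (A : Type*) [CommRing A] [Algebra ℂ A]
    [Algebra.FiniteType ℂ A] (X : Type*) [AddCommGroup X] [Module A X] [Module.Finite A X]
    [Nontrivial X] [Module ℂ X] [IsScalarTower ℂ A X] :
    ∃ L : Submodule A X, L ≠ ⊤ ∧ FiniteDimensional ℂ (X ⧸ L) := by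
  obtain ⟨L, hL, -⟩ := (eq_top_or_exists_le_coatom (⊥ : Submodule A X)).resolve_left bot_ne_top
  refine ⟨L, hL.1, ?_⟩
  have := isSimpleModule_iff_isCoatom.mpr hL
  obtain ⟨m, hm, ⟨e⟩⟩ := isSimpleModule_iff_quot_maximal.mp this
  let _ := Ideal.Quotient.field m
  have : Module.Finite ℂ (A ⧸ m) := finite_of_finite_type_of_isJacobsonRing ℂ (A ⧸ m)
  exact Module.Finite.equiv (e.symm.restrictScalars ℂ)

section FiniteDimensional

variable {ι N : Type*} {V₀ : Type u} [AddCommGroup V₀] [Module ℝ V₀] [AddCommGroup N] [Module ℝ N]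
variable {P : RootPairing ι ℝ V₀ N} {b : SimpleRoots P} {k : Parameter b}

open HeckeAlgebra

theorem Parameter.inversionSum_mem [Finite ι] {E : Type*} [AddCommGroup E] [Module ℂ E]
    (L : Submodule ℂ E) (w : reflectionGroup P) (v : ℂ ⊗[ℝ] V₀) {F : ι → E} (hF : ∀ i, F i ∈ L) :
    k.inversionSum w v F ∈ L := by
  unfold Parameter.inversionSum
  refine Submodule.sum_mem _ fun i _ => ?_
  split_ifs
  · exact Submodule.smul_mem _ _ (hF i)
  · exact zero_mem _

variable (b k) in
/-- The commutative subalgebra generated by `V`. -/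
noncomputable def polySubalgebra : Subalgebra ℂ (HeckeAlgebra b k) :=
  Algebra.adjoin ℂ (Set.range (f b k))

instance : IsMulCommutative (polySubalgebra b k) :=
  Algebra.isMulCommutative_adjoin ℂ (by
    rintro _ ⟨v, rfl⟩ _ ⟨v', rfl⟩
    exact f_comm v v')

instance : Algebra.FiniteType ℂ (polySubalgebra b k) := by
  have hr : Module.IsReflexive ℝ V₀ := .of_isPerfPair P.toLinearMap
  obtain ⟨s, hs⟩ := (Module.Finite.fg_top : (⊤ : Submodule ℂ (ℂ ⊗[ℝ] V₀)).FG)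
  have h : polySubalgebra b k = Algebra.adjoin ℂ (f b k '' (s : Set (ℂ ⊗[ℝ] V₀))) := by
    rw [polySubalgebra, ← Algebra.adjoin_span (R := ℂ) (s := f b k '' _),
      ← Submodule.map_span, hs, ← LinearMap.range_eq_map, LinearMap.coe_range]
  have h2 : (polySubalgebra b k).FG := by
    classical
    exact ⟨s.image (f b k), by rw [h, Finset.coe_image]⟩
  exact (polySubalgebra b k).fg_iff_finiteType.mp h2

theorem f_mem_polySubalgebra (v : ℂ ⊗[ℝ] V₀) : f b k v ∈ polySubalgebra b k :=
  Algebra.subset_adjoin ⟨v, rfl⟩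

variable [Finite ι] [P.IsReduced]
variable {X : Type u} [AddCommGroup X] [Module ℂ X] [Module (HeckeAlgebra b k) X]
variable [IsScalarTower ℂ (HeckeAlgebra b k) X]

/-- A subspace stable under `V` which contains all `t_w y` also contains all `t_w v y`. -/
theorem t_smul_f_smul_mem (L : Submodule ℂ X) (hL : ∀ v, ∀ x ∈ L, f b k v • x ∈ L) {y : X}
    (hy : ∀ w, t b k w • y ∈ L) (w : reflectionGroup P) (v : ℂ ⊗[ℝ] V₀) :
    t b k w • f b k v • y ∈ L := by
  have h := k.map_inversionSum
    ((LinearMap.toSpanSingleton (HeckeAlgebra b k) X y).restrictScalars ℂ) w (act w v)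
    (fun i => t b k (refl P i) * t b k w)
  simp only [LinearMap.restrictScalars_apply, LinearMap.toSpanSingleton_apply] at h
  rw [← mul_smul, t_mul_f, sub_smul, h, mul_smul]
  refine sub_mem (hL _ _ (hy w)) (k.inversionSum_mem L _ _ fun i => ?_)
  rw [← map_mul]
  exact hy _

/-- An irreducible module is generated over the subalgebra generated by `V` by the finitely many
elements `t_w x`, for any `x ≠ 0`. -/
theorem finite_polySubalgebra [IsSimpleModule (HeckeAlgebra b k) X] :
    Module.Finite (polySubalgebra b k) X := by
  have := finite_reflectionGroup P
  have := IsSimpleModule.nontrivial (HeckeAlgebra b k) X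
  obtain ⟨x₀, hx₀⟩ := exists_ne (0 : X)
  set L : Submodule (polySubalgebra b k) X :=
    Submodule.span _ (Set.range fun w : reflectionGroup P => t b k w • x₀) with hL
  have hmem : ∀ w, t b k w • x₀ ∈ L := fun w => Submodule.subset_span ⟨w, rfl⟩
  have hf : ∀ v, ∀ x ∈ L, f b k v • x ∈ L := fun v x hx =>
    L.smul_mem ⟨_, f_mem_polySubalgebra v⟩ hx
  have hz : ∀ (z : ℂ), ∀ x ∈ L, z • x ∈ L := fun z x hx => L.smul_of_tower_mem z hx
  have ha : ∀ a ∈ polySubalgebra b k, ∀ y, (∀ w, t b k w • y ∈ L) → ∀ w, t b k w • a • y ∈ L := by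
    intro a ha
    induction ha using Algebra.adjoin_induction with
    | mem a ha =>
      obtain ⟨v, rfl⟩ := ha
      intro y hy w
      exact t_smul_f_smul_mem (L.restrictScalars ℂ) hf hy w v
    | algebraMap z =>
      intro y hy w
      rw [algebraMap_smul, show t b k w • z • y = z • t b k w • y from
        (Algebra.lsmul ℂ ℂ X (t b k w)).map_smul z y]
      exact hz _ _ (hy w)
    | add a c _ _ ha hc =>
      intro y hy w
      rw [add_smul, smul_add]
      exact add_mem (ha y hy w) (hc y hy w)
    | mul a c _ _ ha hc =>
      intro y hy w
      rw [mul_smul]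
      exact ha _ (hc y hy) w
  have ht : ∀ x ∈ L, ∀ w, t b k w • x ∈ L := by
    intro x hx
    induction hx using Submodule.span_induction with
    | mem x hx =>
      obtain ⟨u, rfl⟩ := hx
      intro w
      dsimp only
      rw [← mul_smul, ← map_mul]
      exact hmem _
    | zero => intro w; rw [smul_zero]; exact zero_mem _
    | add x y _ _ h1 h2 => intro w; rw [smul_add]; exact add_mem (h1 w) (h2 w)
    | smul a x _ h => exact ha a a.2 x h
  have hh : ∀ (h : HeckeAlgebra b k), ∀ x ∈ L, h • x ∈ L := by
    intro h
    induction h using HeckeAlgebra.induction with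
    | halg z => intro x hx; rw [algebraMap_smul]; exact hz _ _ hx
    | ht w => exact fun x hx => ht x hx w
    | hf v => exact hf v
    | hmul a c ha hc => intro x hx; rw [mul_smul]; exact ha _ (hc _ hx)
    | hadd a c ha hc => intro x hx; rw [add_smul]; exact add_mem (ha _ hx) (hc _ hx)
  refine ⟨⟨(Set.finite_range fun w : reflectionGroup P => t b k w • x₀).toFinset, ?_⟩⟩
  rw [Set.Finite.coe_toFinset, ← hL, eq_top_iff]
  intro x _
  obtain ⟨h, rfl⟩ := IsSimpleModule.toSpanSingleton_surjective (HeckeAlgebra b k) hx₀ x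
  have h1 := hmem 1
  rw [map_one, one_smul] at h1
  exact hh h _ h1

open scoped IsMulCommutative in
/-- An irreducible module `X` has a nonzero finite-dimensional quotient `Q` over the subalgebra
generated by `V`, and `x ↦ (w ↦ t_w x)` embeds it into `W → Q` (the module coinduced from `Q`),
because the kernel is a proper submodule. -/
theorem finiteDimensional_of_isSimpleModule [IsSimpleModule (HeckeAlgebra b k) X] :
    FiniteDimensional ℂ X := by
  have := finite_reflectionGroup P
  have := IsSimpleModule.nontrivial (HeckeAlgebra b k) X
  have := finite_polySubalgebra (b := b) (k := k) (X := X)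
  obtain ⟨L, hL, hfin⟩ := exists_ne_top_finite_quotient (polySubalgebra b k) X
  have hf : ∀ v, ∀ x ∈ L, f b k v • x ∈ L := fun v x hx =>
    L.smul_mem ⟨_, f_mem_polySubalgebra v⟩ hx
  let K₀ : Submodule ℂ X :=
    { carrier := {x | ∀ w, t b k w • x ∈ L}
      zero_mem' := fun w => by rw [smul_zero]; exact zero_mem _
      add_mem' := fun hx hy w => by rw [smul_add]; exact add_mem (hx w) (hy w)
      smul_mem' := fun z x hx w => by
        rw [show t b k w • z • x = z • t b k w • x from
          (Algebra.lsmul ℂ ℂ X (t b k w)).map_smul z x]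
        exact L.smul_of_tower_mem z (hx w) }
  have hh : ∀ (h : HeckeAlgebra b k), ∀ x ∈ K₀, h • x ∈ K₀ := by
    intro h
    induction h using HeckeAlgebra.induction with
    | halg z => intro x hx; rw [algebraMap_smul]; exact K₀.smul_mem _ hx
    | ht u =>
      intro x hx w
      rw [← mul_smul, ← map_mul]
      exact hx _
    | hf v => exact fun x hx w => t_smul_f_smul_mem (L.restrictScalars ℂ) hf hx w v
    | hmul a c ha hc => intro x hx; rw [mul_smul]; exact ha _ (hc _ hx)
    | hadd a c ha hc => intro x hx; rw [add_smul]; exact add_mem (ha _ hx) (hc _ hx)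
  let K : Submodule (HeckeAlgebra b k) X := { K₀ with smul_mem' := fun h x hx => hh h x hx }
  have hK : K = ⊥ := by
    refine (eq_bot_or_eq_top K).resolve_right fun h => hL (eq_top_iff.mpr fun x _ => ?_)
    have hx : x ∈ K := h ▸ Submodule.mem_top
    have := hx 1
    rwa [map_one, one_smul] at this
  let φ : X →ₗ[ℂ] (reflectionGroup P → X ⧸ L) :=
    LinearMap.pi fun w => L.mkQ.restrictScalars ℂ ∘ₗ Algebra.lsmul ℂ ℂ X (t b k w)
  refine FiniteDimensional.of_injective φ ((injective_iff_map_eq_zero φ).mpr fun x hx => ?_)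
  have hxK : x ∈ K := fun w => (Submodule.Quotient.mk_eq_zero L).mp (congrFun hx w)
  rwa [hK, Submodule.mem_bot] at hxK

end FiniteDimensional

end GradedHecke

/-- For the graded affine Hecke algebra `ℍ = ℍ(Π, k)`: the rule
`[Y] ↦ ∑_{J ⊆ Π} (-1)^{|J|} [Ind_{ℍ_J}^ℍ Res_{ℍ_J} Y]` is a well-defined endomorphism of the
Grothendieck group of finite-dimensional modules, and every irreducible `ℍ`-module `X` is
finite-dimensional and satisfies that `[𝔻(X)]` is the image of `[X]` under it. -/
theorem mainTheorem5 {ι : Type v} {N : Type w} {V₀ : Type u} [Finite ι]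
    [AddCommGroup V₀] [Module ℝ V₀] [AddCommGroup N] [Module ℝ N]
    (P : RootPairing ι ℝ V₀ N) [P.IsReduced]
    (b : GradedHecke.SimpleRoots P) (k : GradedHecke.Parameter b) :
    ∃ Dt : GradedHecke.Groth (GradedHecke.HeckeAlgebra b k) →+
        GradedHecke.Groth (GradedHecke.HeckeAlgebra b k),
      (∀ Y : GradedHecke.FDModule (GradedHecke.HeckeAlgebra b k),
        Dt Y.cls = ∑ J ∈ b.support.powerset,
          (-1 : ℤ) ^ J.card • (GradedHecke.HeckeAlgebra.indRes J Y).cls) ∧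
      ∀ (X : Type u) [AddCommGroup X] [Module ℂ X] [Module (GradedHecke.HeckeAlgebra b k) X]
        [IsScalarTower ℂ (GradedHecke.HeckeAlgebra b k) X]
        [IsSimpleModule (GradedHecke.HeckeAlgebra b k) X],
        ∃ _ : FiniteDimensional ℂ X,
          (GradedHecke.HeckeAlgebra.D (GradedHecke.FDModule.mk X)).cls =
            Dt (GradedHecke.FDModule.mk X).cls := by
  refine ⟨GradedHecke.alternatingInd b k, GradedHecke.alternatingInd_cls, ?_⟩
  intro X _ _ _ _ _
  exact ⟨GradedHecke.finiteDimensional_of_isSimpleModule (b := b) (k := k),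
    GradedHecke.cls_D_eq _⟩
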